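/- Let $d\in\mathbb N$. All spaces $\mathbb R^D$ carry the Euclidean norm, and $\mathscr P_2(\mathbb R^D)$ denotes the Borel probability measures with finite second moment. Write $\#$ for push-forward and $\mathbb x(x,y^1,\dots,y^n)=x$, $\mathbb y^k(x,y^1,\dots,y^n)=y^k$ for the projections of $(\mathbb R^d)^{n+1}$ onto $\mathbb R^d$. Fix $\varrho\in\mathscr P_2(\mathbb R^d)$ and let $\mathscr P_\varrho(\mathbb R^{2d})$ be the set of $\gamma\in\mathscr P_2(\mathbb R^{2d})$ with $\mathbb x\#\gamma=\varrho$, disintegrated as $\gamma(dx,dy)=\gamma_x(dy)\,\varrho(dx)$. Define $$W_\varrho(\gamma^1,\gamma^2)^2=\int_{\mathbb R^d}W(\gamma^1_x,\gamma^2_x)^2\,\varrho(dx),$$ where $W$ is the quadratic Wasserstein distance on $\mathbb R^d$. Let $\mathrm{ADM}_\varrho(\gamma^1,\gamma^2)$ be the set of $\alpha\in\mathscr P_2(\mathbb R^{3d})$ with $(\mathbb x,\mathbb y^k)\#\alpha=\gamma^k$ for $k=1,2$, and let $\mathrm{OPT}_\varrho(\gamma^1,\gamma^2)$ be the set of those $\alpha\in\mathrm{ADM}_\varrho(\gamma^1,\gamma^2)$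 with $W_\varrho(\gamma^1,\gamma^2)^2=\int|y^1-y^2|^2\,d\alpha$. Put $s\gamma=(\mathbb x,s\mathbb y^1)\#\gamma$ for $s\in\mathbb R$, and $\gamma^1\oplus\gamma^2=\{(\mathbb x,\mathbb y^1+\mathbb y^2)\#\alpha:\alpha\in\mathrm{ADM}_\varrho(\gamma^1,\gamma^2)\}$. A nonempty set $C\subset\mathscr P_\varrho(\mathbb R^{2d})$ is called *closed convex* if * whenever $\gamma^k\in C$, $\gamma\in\mathscr P_\varrho(\mathbb R^{2d})$ and $W_\varrho(\gamma^k,\gamma)\to0$ as $k\to\infty$, then $\gamma\in C$; * $(1-s)\gamma^1\oplus s\gamma^2\subset C$ for all $\gamma^1,\gamma^2\in C$ and $s\in[0,1]$. **Proposition (Metric Projection).** Let $C\subset\mathscr P_\varrho(\mathbb R^{2d})$ be a closed convex set. 1. For every $\upsilon\in\mathscr P_\varrho(\mathbb R^{2d})$ there is a unique $\mathbb P_C(\upsilon)\in C$ with $W_\varrho(\upsilon,\mathbb P_C(\upsilon))\le W_\varrho(\upsilon,\eta)$ for all $\eta\in C$. 2. For every $\upsilon\in\mathscr P_\varrho(\mathbb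 R^{2d})$, every $\eta\in C$ and every $\beta\in\mathscr P_2(\mathbb R^{4d})$ with $$(\mathbb x,\mathbb y^1,\mathbb y^2)\#\beta\in\mathrm{OPT}_\varrho(\upsilon,\mathbb P_C(\upsilon)),\qquad(\mathbb x,\mathbb y^1,\mathbb y^3)\#\beta\in\mathrm{ADM}_\varrho(\upsilon,\eta),$$ we have $$\int_{\mathbb R^{4d}}\langle y^1-y^2,\,y^2-y^3\rangle\,\beta(dx,dy^1,dy^2,dy^3)\ge0.\qquad(*)$$ 3. Conversely, let $\upsilon\in\mathscr P_\varrho(\mathbb R^{2d})$ and $\zeta\in C$. Suppose that for every $\eta\in C$ there is a $\beta\in\mathscr P_2(\mathbb R^{4d})$ with $$(\mathbb x,\mathbb y^1,\mathbb y^2)\#\beta\in\mathrm{ADM}_\varrho(\upsilon,\zeta),\qquad(\mathbb x,\mathbb y^1,\mathbb y^3)\#\beta\in\mathrm{OPT}_\varrho(\upsilon,\eta),$$ for which $(*)$ holds. Then $\zeta=\mathbb P_C(\upsilon)$. 4. For all $\upsilon^1,\upsilon^2\in\mathscr P_\varrho(\mathbb R^{2d})$ and every $\omega\in\mathscr P_2(\mathbb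 R^{5d})$ with $$(\mathbb x,\mathbb y^1,\mathbb y^2)\#\omega\in\mathrm{OPT}_\varrho(\upsilon^1,\mathbb P_C(\upsilon^1)),\qquad(\mathbb x,\mathbb y^3,\mathbb y^4)\#\omega\in\mathrm{OPT}_\varrho(\upsilon^2,\mathbb P_C(\upsilon^2)),$$ we have $$\int_{\mathbb R^{5d}}|y^2-y^4|^2\,d\omega\le\int_{\mathbb R^{5d}}|y^1-y^3|^2\,d\omega.$$ In particular, $W_\varrho(\mathbb P_C(\upsilon^1),\mathbb P_C(\upsilon^2))\le W_\varrho(\upsilon^1,\upsilon^2)$. -/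

import Mathlib

open MeasureTheory ProbabilityTheory Filter Topology
open scoped ENNReal

noncomputable section

namespace FiberedWasserstein

/-- The space `ℝ^d` with its Euclidean inner product and norm. Points of `ℝ^{nd}` are written as
`n`-tuples `(x, y¹, …)` of points of `ℝ^d`. -/
abbrev Vec (d : ℕ) : Type := EuclideanSpace ℝ (Fin d)

/-- Borel probability measures with finite second moment. (On products of `ℝ^d` Lean uses the
maximum norm, which is equivalent to the Euclidean one, so that finiteness of the second moment
has its usual meaning.) -/
structure IsP2 {F : Type*} [NormedAddCommGroup F] [MeasurableSpace F] (μ : Measure F) : Prop where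
  prob : IsProbabilityMeasure μ
  moment : ∫⁻ x, ‖x‖ₑ ^ 2 ∂μ < ∞

/-- The space `𝒫_ρ(ℝ^{2d})`: measures in `𝒫₂(ℝ^{2d})` with first marginal `ρ`. -/
def PRho {d : ℕ} (ρ : Measure (Vec d)) : Type :=
  {γ : Measure (Vec d × Vec d) // IsP2 γ ∧ γ.map Prod.fst = ρ}

/-- The measure on `ℝ^{2d}` underlying an element of `𝒫_ρ(ℝ^{2d})`. -/
def PRho.meas {d : ℕ} {ρ : Measure (Vec d)} (γ : PRho ρ) : Measure (Vec d × Vec d) := γ.1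

instance {d : ℕ} {ρ : Measure (Vec d)} (γ : PRho ρ) : IsProbabilityMeasure γ.meas := γ.2.1.prob

/-- The disintegration `x ↦ γ_x` of `γ(dx,dy) = γ_x(dy) ρ(dx)`. -/
def PRho.disint {d : ℕ} {ρ : Measure (Vec d)} (γ : PRho ρ) : Kernel (Vec d) (Vec d) :=
  γ.meas.condKernel

/-- The defining property of the disintegration. -/
theorem PRho.compProd_disint {d : ℕ} {ρ : Measure (Vec d)} (γ : PRho ρ) :
    ρ ⊗ₘ γ.disint = γ.meas := by
  have h : γ.meas.fst = ρ := γ.2.2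
  have h2 := γ.meas.disintegrate γ.meas.condKernel
  rw [h] at h2
  exact h2

/-- The quadratic Wasserstein distance between probability measures on `ℝ^d`. -/
def wass {d : ℕ} (μ ν : Measure (Vec d)) : ℝ≥0∞ :=
  (⨅ (π : Measure (Vec d × Vec d))
    (_ : IsProbabilityMeasure π ∧ π.map Prod.fst = μ ∧ π.map Prod.snd = ν),
      ∫⁻ p, ‖p.1 - p.2‖ₑ ^ 2 ∂π) ^ (1 / 2 : ℝ)

/-- The fibered distance `W_ρ`, with `W_ρ(γ¹,γ²)² = ∫ W(γ¹_x,γ²_x)² ρ(dx)`. -/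
def wRho {d : ℕ} {ρ : Measure (Vec d)} (γ₁ γ₂ : PRho ρ) : ℝ≥0∞ :=
  (∫⁻ x, wass (γ₁.disint x) (γ₂.disint x) ^ 2 ∂ρ) ^ (1 / 2 : ℝ)

/-- Admissible plans `ADM_ρ(γ¹,γ²)`. -/
def Adm {d : ℕ} {ρ : Measure (Vec d)} (γ₁ γ₂ : PRho ρ) : Set (Measure (Vec d × Vec d × Vec d)) :=
  {α | IsP2 α ∧ α.map (fun p => (p.1, p.2.1)) = γ₁.meas ∧
    α.map (fun p => (p.1, p.2.2)) = γ₂.meas}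

/-- Optimal plans `OPT_ρ(γ¹,γ²)`. -/
def Opt {d : ℕ} {ρ : Measure (Vec d)} (γ₁ γ₂ : PRho ρ) : Set (Measure (Vec d × Vec d × Vec d)) :=
  {α | α ∈ Adm γ₁ γ₂ ∧ wRho γ₁ γ₂ ^ 2 = ∫⁻ p, ‖p.2.1 - p.2.2‖ₑ ^ 2 ∂α}

/-- Scaling of the fibers: `sγ = (x, s y) # γ`. -/
def PRho.scale {d : ℕ} {ρ : Measure (Vec d)} (s : ℝ) (γ : PRho ρ) : PRho ρ :=
  ⟨γ.meas.map (fun p => (p.1, s • p.2)), by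
    have hm : Measurable (fun p : Vec d × Vec d => (p.1, s • p.2)) := by fun_prop
    refine ⟨⟨Measure.isProbabilityMeasure_map hm.aemeasurable, ?_⟩, ?_⟩
    · rw [lintegral_map (by fun_prop) hm]
      have hle : ∀ p : Vec d × Vec d,
          ‖(p.1, s • p.2)‖ₑ ^ 2 ≤ (1 + ‖s‖ₑ) ^ 2 * ‖p‖ₑ ^ 2 := by
        intro p
        rw [← mul_pow]
        gcongr
        have h1 : ‖p.1‖ₑ ≤ ‖p‖ₑ := by
          rw [enorm_le_iff_norm_le]; exact norm_fst_le p
        have h2 : ‖p.2‖ₑ ≤ ‖p‖ₑ := by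
          rw [enorm_le_iff_norm_le]; exact norm_snd_le p
        have h3 : ‖((p.1, s • p.2) : Vec d × Vec d)‖ₑ = max ‖p.1‖ₑ ‖s • p.2‖ₑ := rfl
        rw [h3]
        refine max_le ?_ ?_
        · calc ‖p.1‖ₑ ≤ 1 * ‖p‖ₑ := by simpa using h1
            _ ≤ _ := by gcongr; exact le_self_add
        · calc ‖s • p.2‖ₑ = ‖s‖ₑ * ‖p.2‖ₑ := enorm_smul _ _
            _ ≤ _ := by gcongr; exact le_add_self
      refine (lintegral_mono hle).trans_lt ?_
      rw [lintegral_const_mul _ (by fun_prop)]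
      exact ENNReal.mul_lt_top (by simp [ENNReal.add_lt_top]) γ.2.1.moment
    · rw [Measure.map_map measurable_fst hm]
      exact γ.2.2⟩

/-- The (multivalued) sum `γ¹ ⊕ γ² = {(x, y¹ + y²) # α : α ∈ ADM_ρ(γ¹,γ²)}`. -/
def osum {d : ℕ} {ρ : Measure (Vec d)} (γ₁ γ₂ : PRho ρ) : Set (PRho ρ) :=
  {γ | ∃ α ∈ Adm γ₁ γ₂, γ.meas = α.map (fun p => (p.1, p.2.1 + p.2.2))}

/-- Closed convex subsets of `𝒫_ρ(ℝ^{2d})` (nonempty by definition). -/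
structure IsClosedConvex {d : ℕ} {ρ : Measure (Vec d)} (C : Set (PRho ρ)) : Prop where
  nonempty : C.Nonempty
  closed : ∀ (γs : ℕ → PRho ρ) (γ : PRho ρ), (∀ k, γs k ∈ C) →
    Tendsto (fun k => wRho (γs k) γ) atTop (𝓝 0) → γ ∈ C
  convex : ∀ γ₁ ∈ C, ∀ γ₂ ∈ C, ∀ s ∈ Set.Icc (0 : ℝ) 1,
    osum (γ₁.scale (1 - s)) (γ₂.scale s) ⊆ C

/-- `π` is a closest point to `υ` in `C`. -/
def IsClosestPoint {d : ℕ} {ρ : Measure (Vec d)} (C : Set (PRho ρ)) (υ π : PRho ρ) : Prop :=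
  π ∈ C ∧ ∀ η ∈ C, wRho υ π ≤ wRho υ η

end FiberedWasserstein

end

open FiberedWasserstein

/-! The argument is the Hilbert space one, carried out in `L²` of a plan: measures in `PRho ρ`
become laws of pairs `(X, Y)` on a common probability space, and convexity of `C` gives law`(X, (1 -
s)Y + sY') ∈ C` for every such coupling (`IsClosedConvex.exists_convex_comb`).

For existence, near-minimizers `η`, `η'` are coupled optimally to `υ` and then glued conditionally
independently over `(x, u)`, where `u` is the `υ`-variable. The parallelogram identity
(`IsClosedConvex.integral_sq_sub_le`) bounds the distance of their variables in this gluing. By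
Jensen's inequality one of them may be replaced by its conditional mean given `(x, u)`, a function
on the space of `υ`. Hence these means form a Cauchy sequence in `L²(υ)`. If `T` is the limit, `(x,
T)#υ` is the limit of the near-minimizers, so it lies in `C` and is closest. With zero excess the
same estimate forces every closest point to be the image of `υ` under one and the same map, which is
uniqueness.

The obtuse angle inequality and its converse come from expanding the quadratic `s ↦ ∫|u - (1-s)y -
sy'|²`. Adding two such inequalities gives the contraction.

All this needs optimal plans whose total cost equals the integral of the fiberwise costs. Instead of
selecting optimal fiber plans measurably, one proves weak duality fiber by fiber
(`isDualBound_sqDist`) and obtains a plan from the dual bound by Hahn–Banach and Riesz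
representation (`IsDualBound.exists_measure`). -/

noncomputable section

namespace FiberedWasserstein

/-! ### Kantorovich duality: a functional from Hahn–Banach. -/

section Duality

variable {X Y Z : Type*} [MeasurableSpace Y] [MeasurableSpace Z]

/-- Functions on `X` dominated by a sum of integrable functions of `f` and of `g`. -/
def dominated (f : X → Y) (g : X → Z) (μ : Measure Y) (ν : Measure Z) :
    Submodule ℝ (X → ℝ) where
  carrier := {h | ∃ φ ψ, Integrable φ μ ∧ Integrable ψ ν ∧ ∀ p, |h p| ≤ φ (f p) + ψ (g p)}
  add_mem' := by
    rintro h h' ⟨φ, ψ, hφ, hψ, hh⟩ ⟨φ', ψ', hφ', hψ', hh'⟩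
    refine ⟨φ + φ', ψ + ψ', hφ.add hφ', hψ.add hψ', fun p => (abs_add_le _ _).trans ?_⟩
    have := hh p
    have := hh' p
    simp only [Pi.add_apply]
    linarith
  zero_mem' := ⟨0, 0, integrable_zero _ _ _, integrable_zero _ _ _, fun p => by simp⟩
  smul_mem' := by
    rintro a h ⟨φ, ψ, hφ, hψ, hh⟩
    refine ⟨|a| • φ, |a| • ψ, hφ.smul _, hψ.smul _, fun p => ?_⟩
    simp only [Pi.smul_apply, smul_eq_mul, abs_mul, ← mul_add]
    exact mul_le_mul_of_nonneg_left (hh p) (abs_nonneg a)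

/-- The values of all the upper bounds `φ ∘ f + ψ ∘ g + t c` of `h`, where `c` is given the
value `r`. -/
def upperValues (f : X → Y) (g : X → Z) (μ : Measure Y) (ν : Measure Z) (c : X → ℝ) (r : ℝ)
    (h : X → ℝ) : Set ℝ :=
  {s | ∃ φ ψ t, Integrable φ μ ∧ Integrable ψ ν ∧ 0 ≤ t ∧
    (∀ p, h p ≤ φ (f p) + ψ (g p) + t * c p) ∧ s = ∫ y, φ y ∂μ + ∫ z, ψ z ∂ν + t * r}

variable {f : X → Y} {g : X → Z} {μ : Measure Y} {ν : Measure Z} {c : X → ℝ} {r : ℝ}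

theorem upperValues_nonempty {h : X → ℝ} (hh : h ∈ dominated f g μ ν) :
    (upperValues f g μ ν c r h).Nonempty := by
  obtain ⟨φ, ψ, hφ, hψ, hb⟩ := hh
  exact ⟨_, φ, ψ, 0, hφ, hψ, le_rfl, fun p => by simpa using (le_abs_self _).trans (hb p), rfl⟩

theorem upperValues_add {h h' : X → ℝ} {s s' : ℝ} (hs : s ∈ upperValues f g μ ν c r h)
    (hs' : s' ∈ upperValues f g μ ν c r h') : s + s' ∈ upperValues f g μ ν c r (h + h') := by
  obtain ⟨φ, ψ, t, hφ, hψ, ht, hb, rfl⟩ := hs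
  obtain ⟨φ', ψ', t', hφ', hψ', ht', hb', rfl⟩ := hs'
  refine ⟨φ + φ', ψ + ψ', t + t', hφ.add hφ', hψ.add hψ', add_nonneg ht ht', fun p => ?_, ?_⟩
  · have := hb p
    have := hb' p
    simp only [Pi.add_apply]
    linarith
  · simp only [Pi.add_apply]
    rw [integral_add hφ hφ', integral_add hψ hψ']
    ring

theorem upperValues_smul {h : X → ℝ} {a s : ℝ} (ha : 0 ≤ a)
    (hs : s ∈ upperValues f g μ ν c r h) : a * s ∈ upperValues f g μ ν c r (a • h) := by
  obtain ⟨φ, ψ, t, hφ, hψ, ht, hb, rfl⟩ := hs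
  refine ⟨a • φ, a • ψ, a * t, hφ.smul a, hψ.smul a, mul_nonneg ha ht, fun p => ?_, ?_⟩
  · have := mul_le_mul_of_nonneg_left (hb p) ha
    simp only [Pi.smul_apply, smul_eq_mul]
    linarith
  · simp only [Pi.smul_apply, smul_eq_mul, integral_const_mul]
    ring

/-- `r` bounds the value of the dual problem. -/
def IsDualBound (f : X → Y) (g : X → Z) (μ : Measure Y) (ν : Measure Z) (c : X → ℝ) (r : ℝ) :
    Prop :=
  ∀ φ ψ, Integrable φ μ → Integrable ψ ν → (∀ p, φ (f p) + ψ (g p) ≤ c p) →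
    ∫ y, φ y ∂μ + ∫ z, ψ z ∂ν ≤ r

/-- If `0 ≤ φ + ψ + t c` with `t > 0`, then `(-φ/t, -ψ/t)` is a competitor in the dual problem, and
its bound by `r` is the claim. If `t = 0`, all positive multiples of `(-φ, -ψ)` are competitors
because `c ≥ 0`, so their value cannot be positive. -/
theorem IsDualBound.nonneg_of_mem_upperValues_zero (hr : IsDualBound f g μ ν c r)
    (hc : ∀ p, 0 ≤ c p) {s : ℝ} (hs : s ∈ upperValues f g μ ν c r 0) : 0 ≤ s := by
  obtain ⟨φ, ψ, t, hφ, hψ, ht, hb, rfl⟩ := hs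
  have key : ∀ a : ℝ, 0 ≤ a → a * t ≤ 1 → -(a * (∫ y, φ y ∂μ + ∫ z, ψ z ∂ν)) ≤ r := by
    intro a ha hat
    have := hr (-(a • φ)) (-(a • ψ)) (hφ.smul a).neg (hψ.smul a).neg (fun p => ?_)
    · simp only [Pi.neg_apply, Pi.smul_apply, smul_eq_mul, integral_neg, integral_const_mul]
        at this
      linarith
    · have h1 := mul_le_mul_of_nonneg_left (hb p) ha
      have h2 := mul_le_mul_of_nonneg_right hat (hc p)
      simp only [Pi.neg_apply, Pi.smul_apply, smul_eq_mul, Pi.zero_apply, mul_zero] at h1 ⊢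
      linarith
  rcases ht.eq_or_lt with rfl | ht
  · by_contra! hneg
    have h2 : 0 < -(∫ y, φ y ∂μ + ∫ z, ψ z ∂ν) := by linarith
    obtain ⟨n, hn⟩ := exists_nat_gt (r / -(∫ y, φ y ∂μ + ∫ z, ψ z ∂ν))
    rw [div_lt_iff₀ h2] at hn
    have := key n n.cast_nonneg (by simp)
    linarith
  · have := key t⁻¹ (by positivity) (by rw [inv_mul_cancel₀ ht.ne'])
    have h3 := mul_le_mul_of_nonneg_left this ht.le
    rw [mul_neg, mul_inv_cancel_left₀ ht.ne'] at h3
    linarith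

/-- An upper value of `h` plus one of `-h` is an upper value of `0`, hence nonnegative. -/
theorem IsDualBound.bddBelow_upperValues (hr : IsDualBound f g μ ν c r)
    (hc : ∀ p, 0 ≤ c p) {h : X → ℝ} (hh : h ∈ dominated f g μ ν) :
    BddBelow (upperValues f g μ ν c r h) := by
  obtain ⟨s', hs'⟩ := upperValues_nonempty (c := c) (r := r) (neg_mem hh)
  refine ⟨-s', fun s hs => ?_⟩
  have := upperValues_add hs hs'
  rw [add_neg_cancel] at this
  linarith [hr.nonneg_of_mem_upperValues_zero hc this]

/-- A linear functional below all upper values. -/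
theorem IsDualBound.exists_linearMap (hr : IsDualBound f g μ ν c r) (hc : ∀ p, 0 ≤ c p) :
    ∃ L : dominated f g μ ν →ₗ[ℝ] ℝ, ∀ h, ∀ s ∈ upperValues f g μ ν c r h.1, L h ≤ s := by
  have hle : ∀ (h : dominated f g μ ν) (a : ℝ), 0 < a →
      sInf (upperValues f g μ ν c r (a • h).1) ≤ a * sInf (upperValues f g μ ν c r h.1) := by
    intro h a ha
    rw [← smul_eq_mul, ← Real.sInf_smul_of_nonneg ha.le]
    refine csInf_le_csInf (hr.bddBelow_upperValues hc (a • h).2)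
      ((upperValues_nonempty h.2).smul_set) ?_
    rintro _ ⟨s, hs, rfl⟩
    exact upperValues_smul ha.le hs
  have h0 : (0 : ℝ) ≤ sInf (upperValues f g μ ν c r 0) :=
    Real.sInf_nonneg fun s hs => hr.nonneg_of_mem_upperValues_zero hc hs
  -- The infimum of the upper values is sublinear and nonnegative at `0`, so it dominates the zero
  -- functional on the zero subspace. Positivity, the two marginals and the cost bound are all built
  -- into this one sublinear functional.
  have hext := exists_extension_of_le_sublinear
    (⟨⊥, 0⟩ : dominated f g μ ν →ₗ.[ℝ] ℝ)
    (fun h => sInf (upperValues f g μ ν c r h.1)) (fun a ha h => ?_) (fun h h' => ?_) ?_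
  · obtain ⟨L, -, hL⟩ := hext
    exact ⟨L, fun h s hs => (hL h).trans (csInf_le (hr.bddBelow_upperValues hc h.2) hs)⟩
  · refine le_antisymm (hle h a ha) ?_
    have := mul_le_mul_of_nonneg_left (hle (a • h) a⁻¹ (by positivity)) ha.le
    rwa [inv_smul_smul₀ ha.ne', mul_inv_cancel_left₀ ha.ne'] at this
  · rw [← csInf_add (upperValues_nonempty h.2) (hr.bddBelow_upperValues hc h.2)
      (upperValues_nonempty h'.2) (hr.bddBelow_upperValues hc h'.2)]
    refine csInf_le_csInf (hr.bddBelow_upperValues hc (h + h').2)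
      ((upperValues_nonempty h.2).add (upperValues_nonempty h'.2)) ?_
    rintro _ ⟨s, hs, s', hs', rfl⟩
    exact upperValues_add hs hs'
  · rintro ⟨h, hh⟩
    obtain rfl : h = 0 := hh
    exact h0

theorem mem_dominated_of_bounded [IsFiniteMeasure μ] {h : X → ℝ} {K : ℝ}
    (hK : ∀ p, |h p| ≤ K) : h ∈ dominated f g μ ν :=
  ⟨fun _ => K, 0, integrable_const K, integrable_zero _ _ _, fun p => by simpa using hK p⟩

/-- When `h ≤ h'`, the choice `φ = ψ = 0`, `t = 0` makes `0` an upper value of `h - h'`. -/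
theorem monotone_of_le_upperValues {L : dominated f g μ ν →ₗ[ℝ] ℝ}
    (hL : ∀ h, ∀ s ∈ upperValues f g μ ν c r h.1, L h ≤ s) {h h' : dominated f g μ ν}
    (hh : ∀ p, h.1 p ≤ h'.1 p) : L h ≤ L h' := by
  have := hL (h - h') 0 ⟨0, 0, 0, integrable_zero _ _ _, integrable_zero _ _ _, le_rfl,
    fun p => by simpa using hh p, by simp⟩
  rw [map_sub] at this
  linarith

end Duality

/-! ### Kantorovich duality: representing the functional by a measure. -/

section Duality

open scoped CompactlySupported BoundedContinuousFunction

/-- Compactly supported cutoff functions increasing to `1`. -/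
def cutoff (X : Type*) [NormedAddCommGroup X] [ProperSpace X] (n : ℕ) : C_c(X, ℝ) where
  toFun p := max 0 (1 - ‖p‖ / (n + 1))
  continuous_toFun := by fun_prop
  hasCompactSupport' := by
    refine HasCompactSupport.intro (isCompact_closedBall (0 : X) (n + 1)) fun p hp => ?_
    have h : (n : ℝ) + 1 < ‖p‖ := by simpa using hp
    refine max_eq_left (sub_nonpos.2 ?_)
    rw [le_div_iff₀ (by positivity)]
    linarith

theorem exists_abs_le_of_compactlySupported {X : Type*} [TopologicalSpace X] (h : C_c(X, ℝ)) :
    ∃ K, ∀ p, |h p| ≤ K :=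
  h.hasCompactSupport.exists_bound_of_continuous h.continuous

section Cutoff

variable {X : Type*} [NormedAddCommGroup X] [ProperSpace X]

theorem cutoff_apply (n : ℕ) (p : X) : cutoff X n p = max 0 (1 - ‖p‖ / (n + 1)) := rfl

theorem cutoff_nonneg (n : ℕ) (p : X) : 0 ≤ cutoff X n p := le_max_left _ _

theorem cutoff_le_one (n : ℕ) (p : X) : cutoff X n p ≤ 1 :=
  max_le zero_le_one (sub_le_self _ (by positivity))

theorem one_sub_cutoff_le (n : ℕ) (p : X) : 1 - cutoff X n p ≤ ‖p‖ / (n + 1) := by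
  have : 1 - ‖p‖ / (n + 1) ≤ cutoff X n p := le_max_right _ _
  linarith

theorem abs_mul_cutoff_le (h : X →ᵇ ℝ) (n : ℕ) (p : X) : |h p * cutoff X n p| ≤ ‖h‖ := by
  rw [abs_mul, abs_of_nonneg (cutoff_nonneg n p)]
  exact (mul_le_of_le_one_right (abs_nonneg _) (cutoff_le_one n p)).trans (h.norm_coe_le_norm p)

theorem monotone_cutoff (p : X) : Monotone fun n => cutoff X n p := by
  intro m n hmn
  simp only [cutoff_apply]
  gcongr

theorem tendsto_cutoff (p : X) : Tendsto (fun n => cutoff X n p) atTop (𝓝 1) := by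
  have h : Tendsto (fun n : ℕ => 1 - ‖p‖ / ((n : ℝ) + 1)) atTop (𝓝 (1 - 0)) := by
    refine tendsto_const_nhds.sub ?_
    exact tendsto_const_nhds.div_atTop
      (tendsto_atTop_add_const_right _ _ tendsto_natCast_atTop_atTop)
  rw [sub_zero] at h
  exact tendsto_of_tendsto_of_tendsto_of_le_of_le h tendsto_const_nhds
    (fun n => le_max_right _ _) (fun n => cutoff_le_one n p)

end Cutoff

variable {X Y Z : Type*} [NormedAddCommGroup X] [ProperSpace X] [MeasurableSpace X] [BorelSpace X]
  [NormedAddCommGroup Y] [MeasurableSpace Y] [BorelSpace Y]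
  [NormedAddCommGroup Z] [MeasurableSpace Z] [BorelSpace Z]
  {f : X → Y} {g : X → Z} {μ : Measure Y} {ν : Measure Z}
  [IsProbabilityMeasure μ] [IsProbabilityMeasure ν] {c : X → ℝ} {r : ℝ}

/-- The restriction to compactly supported functions of a functional below all upper values. -/
def compactlySupportedFunctional (L : dominated f g μ ν →ₗ[ℝ] ℝ)
    (hL : ∀ h, ∀ s ∈ upperValues f g μ ν c r h.1, L h ≤ s) : C_c(X, ℝ) →ₚ[ℝ] ℝ :=
  PositiveLinearMap.mk₀
    { toFun := fun h => L ⟨h, mem_dominated_of_bounded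
        (exists_abs_le_of_compactlySupported h).choose_spec⟩
      map_add' := fun h h' => by rw [← map_add]; rfl
      map_smul' := fun a h => by rw [← map_smul]; rfl }
    (fun h hh => by
      rw [← map_zero L]
      exact monotone_of_le_upperValues hL fun p => hh p)

/-- A form of Kantorovich duality for measures with two prescribed images. -/
theorem IsDualBound.exists_measure (hf : Continuous f) (hg : Continuous g)
    (hfg : ∀ p, ‖p‖ ≤ ‖f p‖ + ‖g p‖) (hμ : Integrable (fun y => ‖y‖) μ)
    (hν : Integrable (fun z => ‖z‖) ν) (hc : Continuous c) (hc0 : ∀ p, 0 ≤ c p)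
    (hcd : c ∈ dominated f g μ ν) (hr : IsDualBound f g μ ν c r) :
    ∃ α : Measure X, IsProbabilityMeasure α ∧ α.map f = μ ∧ α.map g = ν ∧
      ∫⁻ p, ENNReal.ofReal (c p) ∂α ≤ ENNReal.ofReal r := by
  obtain ⟨L, hL⟩ := hr.exists_linearMap hc0
  set Λ := compactlySupportedFunctional L hL
  set α := RealRMK.rieszMeasure Λ
  have hint : ∀ (h : C_c(X, ℝ)) (hh : (h : X → ℝ) ∈ dominated f g μ ν),
      ∫ p, h p ∂α = L ⟨h, hh⟩ := fun h hh => RealRMK.integral_rieszMeasure Λ h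
  -- Both `φ ∘ f` and its negative have their own integral as an upper value, which pins down `L`.
  have hLf : ∀ (φ : Y → ℝ) (hφ : Integrable φ μ) (h : φ ∘ f ∈ dominated f g μ ν),
      L ⟨φ ∘ f, h⟩ = ∫ y, φ y ∂μ := by
    intro φ hφ h
    have h1 := hL ⟨φ ∘ f, h⟩ _ ⟨φ, 0, 0, hφ, integrable_zero _ _ _, le_rfl,
      fun p => by simp, rfl⟩
    have h2 := hL (-⟨φ ∘ f, h⟩) _ ⟨-φ, 0, 0, hφ.neg, integrable_zero _ _ _, le_rfl,
      fun p => by simp, rfl⟩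
    simp only [map_neg, Pi.neg_apply, integral_neg, Pi.zero_apply, integral_zero, zero_mul,
      add_zero] at h1 h2
    linarith
  have hLg : ∀ (ψ : Z → ℝ) (hψ : Integrable ψ ν) (h : ψ ∘ g ∈ dominated f g μ ν),
      L ⟨ψ ∘ g, h⟩ = ∫ z, ψ z ∂ν := by
    intro ψ hψ h
    have h1 := hL ⟨ψ ∘ g, h⟩ _ ⟨0, ψ, 0, integrable_zero _ _ _, hψ, le_rfl,
      fun p => by simp, rfl⟩
    have h2 := hL (-⟨ψ ∘ g, h⟩) _ ⟨0, -ψ, 0, integrable_zero _ _ _, hψ.neg, le_rfl,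
      fun p => by simp, rfl⟩
    simp only [map_neg, Pi.neg_apply, integral_neg, Pi.zero_apply, integral_zero, zero_mul,
      add_zero, zero_add] at h1 h2
    linarith
  -- the functional is continuous along the cutoffs
  have hlim : ∀ (h : X →ᵇ ℝ) (hh : (h : X → ℝ) ∈ dominated f g μ ν),
      Tendsto (fun n => ∫ p, h p * cutoff X n p ∂α) atTop (𝓝 (L ⟨h, hh⟩)) := by
    intro h hh
    set M := ∫ y, ‖y‖ ∂μ + ∫ z, ‖z‖ ∂ν with hM
    -- This is tightness: no mass escapes to infinity, since `1 - cutoff ≤ ‖p‖ / (n + 1)` and `‖p‖`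
    -- is dominated by functions of `f p` and `g p` with finite first moments.
    have hbd : ∀ n : ℕ, |∫ p, h p * cutoff X n p ∂α - L ⟨h, hh⟩| ≤ ‖h‖ * M / (n + 1) := by
      intro n
      have hmul : ∫ p, h p * cutoff X n p ∂α = L ⟨fun p => h p * cutoff X n p,
          mem_dominated_of_bounded (abs_mul_cutoff_le h n)⟩ :=
        hint ⟨⟨fun p => h p * cutoff X n p, h.continuous.mul (cutoff X n).continuous⟩,
          (cutoff X n).hasCompactSupport.mul_left⟩ _
      rw [hmul, ← map_sub]
      have hpt : ∀ p, |h p * cutoff X n p - h p| ≤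
          ‖h‖ / (n + 1) * ‖f p‖ + ‖h‖ / (n + 1) * ‖g p‖ := by
        intro p
        have h1 : h p * cutoff X n p - h p = -(h p * (1 - cutoff X n p)) := by ring
        rw [h1, abs_neg, abs_mul, abs_of_nonneg (sub_nonneg.2 (cutoff_le_one n p))]
        calc |h p| * (1 - cutoff X n p) ≤ ‖h‖ * (‖p‖ / (n + 1)) :=
              mul_le_mul (h.norm_coe_le_norm p) (one_sub_cutoff_le n p)
                (sub_nonneg.2 (cutoff_le_one n p)) (norm_nonneg _)
          _ = ‖h‖ / (n + 1) * ‖p‖ := by ring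
          _ ≤ ‖h‖ / (n + 1) * (‖f p‖ + ‖g p‖) := by gcongr; exact hfg p
          _ = _ := by ring
      have hval : ‖h‖ * M / (n + 1) = ∫ y, ‖h‖ / (n + 1) * ‖y‖ ∂μ +
          ∫ z, ‖h‖ / (n + 1) * ‖z‖ ∂ν + 0 * r := by
        rw [integral_const_mul, integral_const_mul, hM]
        ring
      rw [hval, abs_le']
      refine ⟨hL _ _ ⟨_, _, 0, hμ.const_mul _, hν.const_mul _, le_rfl, fun p => ?_, rfl⟩, ?_⟩
      · rw [zero_mul, add_zero]
        exact (le_abs_self _).trans (hpt p)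
      · rw [← map_neg]
        refine hL _ _ ⟨_, _, 0, hμ.const_mul _, hν.const_mul _, le_rfl, fun p => ?_, rfl⟩
        rw [zero_mul, add_zero]
        exact (neg_le_abs _).trans (hpt p)
    rw [tendsto_iff_norm_sub_tendsto_zero]
    refine squeeze_zero (fun n => norm_nonneg _) hbd ?_
    exact tendsto_const_nhds.div_atTop
      (tendsto_atTop_add_const_right _ _ tendsto_natCast_atTop_atTop)
  have hprob : IsProbabilityMeasure α := by
    constructor
    have h1mem : ((1 : X →ᵇ ℝ) : X → ℝ) ∈ dominated f g μ ν :=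
      mem_dominated_of_bounded (K := 1) fun p => by simp
    have hL1 : L ⟨(1 : X →ᵇ ℝ), h1mem⟩ = 1 := by
      have := hLf (fun _ => 1) (integrable_const 1) h1mem
      rw [integral_const, probReal_univ, one_smul] at this
      exact this
    have h1 := hlim 1 h1mem
    rw [hL1] at h1
    simp only [BoundedContinuousFunction.coe_one, Pi.one_apply, one_mul] at h1
    have h2 : Tendsto (fun n => ∫⁻ p, ENNReal.ofReal (cutoff X n p) ∂α) atTop
        (𝓝 (∫⁻ _, 1 ∂α)) := by
      refine lintegral_tendsto_of_tendsto_of_monotone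
        (fun n => (cutoff X n).continuous.measurable.ennreal_ofReal.aemeasurable)
        (ae_of_all _ fun p m n hmn => ENNReal.ofReal_le_ofReal (monotone_cutoff p hmn))
        (ae_of_all _ fun p => ?_)
      simpa using ENNReal.tendsto_ofReal (tendsto_cutoff p)
    have h3 := ENNReal.tendsto_ofReal h1
    simp only [ENNReal.ofReal_one] at h3
    have h4 : ∀ n, ∫⁻ p, ENNReal.ofReal (cutoff X n p) ∂α
        = ENNReal.ofReal (∫ p, cutoff X n p ∂α) := fun n =>
      (ofReal_integral_eq_lintegral_ofReal (cutoff X n).integrable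
        (ae_of_all _ (cutoff_nonneg n))).symm
    simp only [h4, lintegral_one] at h2
    exact tendsto_nhds_unique h2 h3
  have hbdd : ∀ (h : X →ᵇ ℝ) (hh : (h : X → ℝ) ∈ dominated f g μ ν),
      ∫ p, h p ∂α = L ⟨h, hh⟩ := by
    intro h hh
    refine tendsto_nhds_unique ?_ (hlim h hh)
    refine tendsto_integral_of_dominated_convergence (fun _ => ‖h‖)
      (fun n => (h.continuous.mul (cutoff X n).continuous).aestronglyMeasurable)
      (integrable_const _) (fun n => ae_of_all _ (abs_mul_cutoff_le h n)) (ae_of_all _ fun p => ?_)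
    simpa using (tendsto_cutoff p).const_mul (h p)
  refine ⟨α, hprob, ?_, ?_, ?_⟩
  · have := Measure.isProbabilityMeasure_map (μ := α) hf.measurable.aemeasurable
    refine ext_of_forall_integral_eq_of_IsFiniteMeasure fun u => ?_
    rw [integral_map hf.measurable.aemeasurable u.continuous.aestronglyMeasurable]
    have hu : ((u.compContinuous ⟨f, hf⟩ : X →ᵇ ℝ) : X → ℝ) ∈ dominated f g μ ν :=
      mem_dominated_of_bounded (K := ‖u‖) fun p => u.norm_coe_le_norm (f p)
    exact (hbdd _ hu).trans (hLf u (u.integrable μ) hu)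
  · have := Measure.isProbabilityMeasure_map (μ := α) hg.measurable.aemeasurable
    refine ext_of_forall_integral_eq_of_IsFiniteMeasure fun u => ?_
    rw [integral_map hg.measurable.aemeasurable u.continuous.aestronglyMeasurable]
    have hu : ((u.compContinuous ⟨g, hg⟩ : X →ᵇ ℝ) : X → ℝ) ∈ dominated f g μ ν :=
      mem_dominated_of_bounded (K := ‖u‖) fun p => u.norm_coe_le_norm (g p)
    exact (hbdd _ hu).trans (hLg u (u.integrable ν) hu)
  -- The choice `φ = ψ = 0`, `t = 1` is where the value `r` assigned to `c` enters. As `c` may be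
  -- unbounded, it reaches `α` only through cutoffs and monotone convergence.
  · have hLc : L ⟨c, hcd⟩ ≤ r := hL _ _ ⟨0, 0, 1, integrable_zero _ _ _, integrable_zero _ _ _,
      zero_le_one, fun p => by simp, by simp⟩
    have htend : Tendsto (fun n => ∫⁻ p, ENNReal.ofReal (c p * cutoff X n p) ∂α) atTop
        (𝓝 (∫⁻ p, ENNReal.ofReal (c p) ∂α)) := by
      refine lintegral_tendsto_of_tendsto_of_monotone
        (fun n => (hc.mul (cutoff X n).continuous).measurable.ennreal_ofReal.aemeasurable)
        (ae_of_all _ fun p m n hmn => ENNReal.ofReal_le_ofReal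
          (mul_le_mul_of_nonneg_left (monotone_cutoff p hmn) (hc0 p)))
        (ae_of_all _ fun p => ENNReal.tendsto_ofReal ?_)
      simpa using (tendsto_cutoff p).const_mul (c p)
    refine le_of_tendsto' htend fun n => ?_
    set k : C_c(X, ℝ) := ⟨⟨fun p => c p * cutoff X n p, hc.mul (cutoff X n).continuous⟩,
      (cutoff X n).hasCompactSupport.mul_left⟩
    have hkd : (k : X → ℝ) ∈ dominated f g μ ν :=
      mem_dominated_of_bounded (exists_abs_le_of_compactlySupported k).choose_spec
    have hk1 : ∫⁻ p, ENNReal.ofReal (c p * cutoff X n p) ∂α = ENNReal.ofReal (∫ p, k p ∂α) :=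
      (ofReal_integral_eq_lintegral_ofReal k.integrable
        (ae_of_all _ fun p => mul_nonneg (hc0 p) (cutoff_nonneg n p))).symm
    rw [hk1, hint k hkd]
    refine ENNReal.ofReal_le_ofReal (le_trans ?_ hLc)
    exact monotone_of_le_upperValues hL fun p =>
      mul_le_of_le_one_right (hc0 p) (cutoff_le_one n p)

end Duality

/-! ### Second moments and integrals. -/

section Integrability

theorem isP2_iff {F : Type*} [NormedAddCommGroup F] [SecondCountableTopology F]
    [MeasurableSpace F] [BorelSpace F] {μ : Measure F} :
    IsP2 μ ↔ IsProbabilityMeasure μ ∧ MemLp id 2 μ := by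
  have h : MemLp id 2 μ ↔ ∫⁻ x, ‖x‖ₑ ^ 2 ∂μ < ∞ := by
    rw [MemLp, eLpNorm_lt_top_iff_lintegral_rpow_enorm_lt_top (by simp) (by simp)]
    simp [measurable_id.aestronglyMeasurable]
  exact ⟨fun hμ => ⟨hμ.prob, h.2 hμ.moment⟩, fun hμ => ⟨hμ.1, h.1 hμ.2⟩⟩

theorem isP2_map_iff {Ω F : Type*} [MeasurableSpace Ω] {P : Measure Ω} [IsProbabilityMeasure P]
    [NormedAddCommGroup F] [SecondCountableTopology F]
    [MeasurableSpace F] [BorelSpace F] {f : Ω → F} (hf : Measurable f) :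
    IsP2 (P.map f) ↔ MemLp f 2 P := by
  rw [isP2_iff, memLp_map_measure_iff measurable_id.aestronglyMeasurable hf.aemeasurable]
  simp [Measure.isProbabilityMeasure_map hf.aemeasurable]

theorem lintegral_enorm_sq {Ω F : Type*} [MeasurableSpace Ω] {P : Measure Ω}
    [NormedAddCommGroup F] {f : Ω → F} (hf : MemLp f 2 P) :
    ∫⁻ ω, ‖f ω‖ₑ ^ 2 ∂P = ENNReal.ofReal (∫ ω, ‖f ω‖ ^ 2 ∂P) := by
  rw [ofReal_integral_eq_lintegral_ofReal
    ((memLp_two_iff_integrable_sq_norm hf.1).1 hf) (ae_of_all _ fun ω => by positivity)]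
  refine lintegral_congr fun ω => ?_
  rw [ENNReal.ofReal_pow (norm_nonneg _), ofReal_norm]

theorem ofReal_integral_le_lintegral_ofReal {Ω : Type*} [MeasurableSpace Ω] {P : Measure Ω}
    {f : Ω → ℝ} (hf : Integrable f P) :
    ENNReal.ofReal (∫ ω, f ω ∂P) ≤ ∫⁻ ω, ENNReal.ofReal (f ω) ∂P := by
  calc ENNReal.ofReal (∫ ω, f ω ∂P) ≤ ENNReal.ofReal (∫ ω, max (f ω) 0 ∂P) :=
        ENNReal.ofReal_le_ofReal (integral_mono hf hf.pos_part fun ω => le_max_left _ _)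
    _ = ∫⁻ ω, ENNReal.ofReal (max (f ω) 0) ∂P :=
        ofReal_integral_eq_lintegral_ofReal hf.pos_part (ae_of_all _ fun ω => le_max_right _ _)
    _ = ∫⁻ ω, ENNReal.ofReal (f ω) ∂P := by simp

theorem integrable_integral_of_compProd {A B : Type*} [MeasurableSpace A] [MeasurableSpace B]
    {μ : Measure A} [SFinite μ] {κ : Kernel A B} [IsSFiniteKernel κ]
    {E : Type*} [NormedAddCommGroup E] [NormedSpace ℝ E] {f : A × B → E}
    (hf : Integrable f (μ ⊗ₘ κ)) : Integrable (fun a => ∫ b, f (a, b) ∂(κ a)) μ := by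
  rw [Measure.compProd] at hf
  simpa using hf.integral_compProd

end Integrability

/-! ### Conditionally independent gluing. -/

section Gluing

variable {A B C : Type*} [MeasurableSpace A] [MeasurableSpace B] [StandardBorelSpace B]
    [Nonempty B] [MeasurableSpace C] [StandardBorelSpace C] [Nonempty C]

/-- The gluing of two measures along their first marginal, with conditionally independent
second components. -/
def glue (μ : Measure (A × B)) (ν : Measure (A × C)) [IsFiniteMeasure μ] [IsFiniteMeasure ν] :
    Measure (A × B × C) :=
  μ.fst ⊗ₘ (μ.condKernel ×ₖ ν.condKernel)

variable (μ : Measure (A × B)) (ν : Measure (A × C)) [IsProbabilityMeasure μ]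
  [IsProbabilityMeasure ν]

theorem map_left_glue : (glue μ ν).map (fun p => (p.1, p.2.1)) = μ := by
  have := Measure.compProd_map (μ := μ.fst) (κ := μ.condKernel ×ₖ ν.condKernel) measurable_fst
  rw [← Kernel.fst_eq, Kernel.fst_prod, μ.disintegrate μ.condKernel] at this
  exact this.symm

/-- The gluing takes its base measure from `μ`, so only this marginal needs the two bases to agree.
-/
theorem map_right_glue (h : μ.fst = ν.fst) :
    (glue μ ν).map (fun p => (p.1, p.2.2)) = ν := by
  have := Measure.compProd_map (μ := μ.fst) (κ := μ.condKernel ×ₖ ν.condKernel) measurable_snd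
  rw [← Kernel.snd_eq, Kernel.snd_prod, h, ν.disintegrate ν.condKernel] at this
  rw [glue, h]
  exact this.symm

theorem lintegral_glue {F : A × B × C → ℝ≥0∞} (hF : Measurable F) :
    ∫⁻ p, F p ∂(glue μ ν) =
      ∫⁻ a, ∫⁻ b, ∫⁻ c, F (a, b, c) ∂(ν.condKernel a) ∂(μ.condKernel a) ∂μ.fst := by
  rw [glue, Measure.lintegral_compProd hF]
  refine lintegral_congr fun a => ?_
  rw [Kernel.prod_apply, lintegral_prod _ (by fun_prop)]

end Gluing

/-! ### Fibered plans, the fibered distance and optimal plans. -/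

variable {d : ℕ} {ρ : Measure (Vec d)}

instance (γ : PRho ρ) : IsMarkovKernel γ.disint := by
  unfold PRho.disint
  infer_instance

theorem PRho.isP2_meas (γ : PRho ρ) : IsP2 γ.meas := γ.2.1

theorem PRho.map_fst_meas (γ : PRho ρ) : γ.meas.map Prod.fst = ρ := γ.2.2

theorem PRho.isProbabilityMeasure_base (γ : PRho ρ) : IsProbabilityMeasure ρ := by
  rw [← γ.map_fst_meas]
  exact Measure.isProbabilityMeasure_map measurable_fst.aemeasurable

theorem PRho.ext_meas {γ γ' : PRho ρ} (h : γ.meas = γ'.meas) : γ = γ' := Subtype.ext h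

section RandomVariables

variable {Ω : Type*} [MeasurableSpace Ω] {P : Measure Ω} {X Y Y' : Ω → Vec d} {γ γ₁ γ₂ : PRho ρ}

theorem PRho.isProbabilityMeasure_of_map_eq (hX : Measurable X) (hY : Measurable Y)
    (h : P.map (fun ω => (X ω, Y ω)) = γ.meas) : IsProbabilityMeasure P := by
  constructor
  have := measure_univ (μ := γ.meas)
  rwa [← h, Measure.map_apply (by fun_prop) MeasurableSet.univ, Set.preimage_univ] at this

theorem PRho.memLp_of_map_eq (hX : Measurable X) (hY : Measurable Y)
    (h : P.map (fun ω => (X ω, Y ω)) = γ.meas) : MemLp X 2 P ∧ MemLp Y 2 P := by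
  have := PRho.isProbabilityMeasure_of_map_eq hX hY h
  have h2 := γ.isP2_meas
  rw [← h, isP2_map_iff (by fun_prop)] at h2
  exact ⟨h2.fst, h2.snd⟩

/-- The second moment of the triple is automatic from those of the two pairs. This is the bridge
between plans and random variables. -/
theorem map_mem_adm_iff (hX : Measurable X) (hY : Measurable Y) (hY' : Measurable Y') :
    P.map (fun ω => (X ω, Y ω, Y' ω)) ∈ Adm γ₁ γ₂ ↔
      P.map (fun ω => (X ω, Y ω)) = γ₁.meas ∧ P.map (fun ω => (X ω, Y' ω)) = γ₂.meas := by
  rw [Adm, Set.mem_ofPred_eq, Measure.map_map (by fun_prop) (by fun_prop),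
    Measure.map_map (by fun_prop) (by fun_prop)]
  refine ⟨fun h => h.2, fun h => ⟨?_, h⟩⟩
  have := PRho.isProbabilityMeasure_of_map_eq hX hY h.1
  rw [isP2_map_iff (by fun_prop)]
  obtain ⟨h1, h2⟩ := PRho.memLp_of_map_eq hX hY h.1
  exact memLp_prod_iff.2 ⟨h1, memLp_prod_iff.2 ⟨h2, (PRho.memLp_of_map_eq hX hY' h.2).2⟩⟩

theorem mem_adm_of_map_eq {α : Measure (Vec d × Vec d × Vec d)}
    (h₁ : α.map (fun p => (p.1, p.2.1)) = γ₁.meas)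
    (h₂ : α.map (fun p => (p.1, p.2.2)) = γ₂.meas) : α ∈ Adm γ₁ γ₂ := by
  have := (map_mem_adm_iff (P := α) (X := fun p => p.1) (Y := fun p => p.2.1)
    (Y' := fun p => p.2.2) (by fun_prop) (by fun_prop) (by fun_prop)).2 ⟨h₁, h₂⟩
  simpa using this

end RandomVariables

theorem exists_mem_adm (γ₁ γ₂ : PRho ρ) : ∃ α, α ∈ Adm γ₁ γ₂ :=
   ⟨glue γ₁.meas γ₂.meas, mem_adm_of_map_eq (map_left_glue _ _)
    (map_right_glue _ _ (γ₁.map_fst_meas.trans γ₂.map_fst_meas.symm))⟩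

theorem wass_sq (μ ν : Measure (Vec d)) :
    wass μ ν ^ 2 = ⨅ (π : Measure (Vec d × Vec d))
      (_ : IsProbabilityMeasure π ∧ π.map Prod.fst = μ ∧ π.map Prod.snd = ν),
        ∫⁻ p, ‖p.1 - p.2‖ₑ ^ 2 ∂π := by
  rw [wass, ← ENNReal.rpow_natCast, ← ENNReal.rpow_mul]
  norm_num

theorem wRho_sq (γ₁ γ₂ : PRho ρ) :
    wRho γ₁ γ₂ ^ 2 = ∫⁻ x, wass (γ₁.disint x) (γ₂.disint x) ^ 2 ∂ρ := by
  rw [wRho, ← ENNReal.rpow_natCast, ← ENNReal.rpow_mul]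
  norm_num

/-- The fibers of an image measure are the images of the fibers. -/
theorem PRho.map_condKernel_ae_eq {B : Type*} [MeasurableSpace B] [StandardBorelSpace B]
    [Nonempty B] {α : Measure (Vec d × B)} [IsProbabilityMeasure α] {g : B → Vec d}
    (hg : Measurable g) {γ : PRho ρ} (h : α.map (Prod.map id g) = γ.meas) :
    ∀ᵐ x ∂ρ, (α.condKernel x).map g = γ.disint x := by
  have hfst : γ.meas.fst = α.fst := by
    rw [← h, Measure.fst, Measure.map_map measurable_fst (by fun_prop)]
    rfl
  have := eq_condKernel_of_measure_eq_compProd (ρ := γ.meas) (α.condKernel.map g) (by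
    rw [hfst, Measure.compProd_map hg, α.disintegrate α.condKernel, h])
  rw [show γ.meas.fst = ρ from γ.map_fst_meas] at this
  filter_upwards [this] with x hx
  rw [← Kernel.map_apply _ hg]
  exact hx

/-- Admissible plans bound the fibered distance from above. -/
theorem wRho_sq_le_of_mem_adm {γ₁ γ₂ : PRho ρ} {α : Measure (Vec d × Vec d × Vec d)}
    (hα : α ∈ Adm γ₁ γ₂) : wRho γ₁ γ₂ ^ 2 ≤ ∫⁻ p, ‖p.2.1 - p.2.2‖ₑ ^ 2 ∂α := by
  obtain ⟨hP, h1, h2⟩ := hα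
  have := hP.prob
  have hfst : α.fst = ρ := by
    rw [← γ₁.map_fst_meas, ← h1, Measure.map_map (by fun_prop) (by fun_prop)]
    rfl
  have key : ∫⁻ p, ‖p.2.1 - p.2.2‖ₑ ^ 2 ∂α
      = ∫⁻ x, ∫⁻ q, ‖q.1 - q.2‖ₑ ^ 2 ∂(α.condKernel x) ∂ρ := by
    conv_lhs => rw [← α.disintegrate α.condKernel]
    rw [Measure.lintegral_compProd (by fun_prop), hfst]
  rw [key, wRho_sq]
  -- The fibers of `α` are competitors for almost every `x`. Monotonicity of the lower integral does
  -- not require `x ↦ W(γ¹_x, γ²_x)` to be measurable.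
  refine lintegral_mono_ae ?_
  filter_upwards [PRho.map_condKernel_ae_eq measurable_fst h1,
    PRho.map_condKernel_ae_eq measurable_snd h2] with x hx1 hx2
  rw [wass_sq]
  exact iInf₂_le _ ⟨inferInstance, hx1, hx2⟩

theorem wRho_sq_lt_top (γ₁ γ₂ : PRho ρ) : wRho γ₁ γ₂ ^ 2 < ∞ := by
  obtain ⟨α, hα⟩ := exists_mem_adm γ₁ γ₂
  refine (wRho_sq_le_of_mem_adm hα).trans_lt ?_
  have := hα.1.prob
  have h := (isP2_iff.1 hα.1).2.snd
  have h' : MemLp (fun p : Vec d × Vec d × Vec d => p.2.1 - p.2.2) 2 α := h.fst.sub h.snd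
  rw [lintegral_enorm_sq h']
  exact ENNReal.ofReal_lt_top

/-- The squared fibered distance as a real number. -/
def sqDist (γ₁ γ₂ : PRho ρ) : ℝ := (wRho γ₁ γ₂ ^ 2).toReal

theorem ofReal_sqDist (γ₁ γ₂ : PRho ρ) : ENNReal.ofReal (sqDist γ₁ γ₂) = wRho γ₁ γ₂ ^ 2 :=
  ENNReal.ofReal_toReal (wRho_sq_lt_top γ₁ γ₂).ne

theorem sqDist_nonneg (γ₁ γ₂ : PRho ρ) : 0 ≤ sqDist γ₁ γ₂ := ENNReal.toReal_nonneg

theorem sqDist_le_sqDist_iff {γ₁ γ₂ γ₃ γ₄ : PRho ρ} :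
    sqDist γ₁ γ₂ ≤ sqDist γ₃ γ₄ ↔ wRho γ₁ γ₂ ≤ wRho γ₃ γ₄ := by
  rw [sqDist, sqDist, ENNReal.toReal_le_toReal (wRho_sq_lt_top _ _).ne (wRho_sq_lt_top _ _).ne,
    ENNReal.pow_le_pow_left_iff (by norm_num)]

/-- Weak duality, fiber by fiber. -/
theorem isDualBound_sqDist (γ₁ γ₂ : PRho ρ) :
    IsDualBound (fun p : Vec d × Vec d × Vec d => (p.1, p.2.1)) (fun p => (p.1, p.2.2))
      γ₁.meas γ₂.meas (fun p => ‖p.2.1 - p.2.2‖ ^ 2) (sqDist γ₁ γ₂) := by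
  intro φ ψ hφ hψ hb
  have := γ₁.isProbabilityMeasure_base
  rw [← γ₁.compProd_disint] at hφ ⊢
  rw [← γ₂.compProd_disint] at hψ ⊢
  have hφ1 := (Measure.integrable_compProd_iff hφ.1).1 hφ
  have hψ1 := (Measure.integrable_compProd_iff hψ.1).1 hψ
  have hφ2 := integrable_integral_of_compProd hφ
  have hψ2 := integrable_integral_of_compProd hψ
  rw [Measure.integral_compProd hφ, Measure.integral_compProd hψ, ← integral_add hφ2 hψ2]
  refine (ENNReal.ofReal_le_ofReal_iff (sqDist_nonneg _ _)).1 ?_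
  rw [ofReal_sqDist, wRho_sq]
  refine (ofReal_integral_le_lintegral_ofReal (hφ2.add hψ2)).trans (lintegral_mono_ae ?_)
  filter_upwards [hφ1.1, hψ1.1] with x hx hy
  rw [wass_sq]
  -- In a fixed fiber, integrate `φ(x, y) + ψ(x, y') ≤ |y - y'|²` against an arbitrary coupling.
  refine le_iInf₂ fun π hπ => ?_
  obtain ⟨hπ0, hπ1, hπ2⟩ := hπ
  simp only [Pi.add_apply]
  rw [← hπ1] at hx ⊢
  rw [← hπ2] at hy ⊢
  rw [integral_map measurable_fst.aemeasurable hx.1, integral_map measurable_snd.aemeasurable hy.1]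
  have hx' : Integrable (fun p : Vec d × Vec d => φ (x, p.1)) π :=
    hx.comp_measurable measurable_fst
  have hy' : Integrable (fun p : Vec d × Vec d => ψ (x, p.2)) π :=
    hy.comp_measurable measurable_snd
  rw [← integral_add hx' hy']
  refine (ofReal_integral_le_lintegral_ofReal (hx'.add hy')).trans (lintegral_mono fun p => ?_)
  rw [← ofReal_norm, ← ENNReal.ofReal_pow (norm_nonneg _)]
  exact ENNReal.ofReal_le_ofReal (hb (x, p.1, p.2))

/-- Duality applies on the whole space, with the maps `(x, y¹)` and `(x, y²)` in the role of the
marginals. The squared fibered distance bounds the dual problem, so some plan costs no more than it;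
admissible plans never cost less. -/
theorem exists_mem_opt (γ₁ γ₂ : PRho ρ) : ∃ α, α ∈ Opt γ₁ γ₂ := by
  have hm : ∀ γ : PRho ρ, MemLp id 2 γ.meas := fun γ => (isP2_iff.1 γ.isP2_meas).2
  have hm2 : ∀ γ : PRho ρ, MemLp (fun p : Vec d × Vec d => p.2) 2 γ.meas := fun γ => (hm γ).snd
  have hcd : (fun p : Vec d × Vec d × Vec d => ‖p.2.1 - p.2.2‖ ^ 2) ∈ dominated
      (fun p => (p.1, p.2.1)) (fun p => (p.1, p.2.2)) γ₁.meas γ₂.meas := by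
    refine ⟨fun q => 2 * ‖q.2‖ ^ 2, fun q => 2 * ‖q.2‖ ^ 2,
      ((memLp_two_iff_integrable_sq_norm (hm2 γ₁).1).1 (hm2 γ₁)).const_mul 2,
      ((memLp_two_iff_integrable_sq_norm (hm2 γ₂).1).1 (hm2 γ₂)).const_mul 2, fun p => ?_⟩
    have h1 := norm_sub_le p.2.1 p.2.2
    have h2 := norm_nonneg (p.2.1 - p.2.2)
    rw [abs_of_nonneg (by positivity)]
    simp only
    nlinarith [sq_nonneg (‖p.2.1‖ - ‖p.2.2‖)]
  have hnorm : ∀ p : Vec d × Vec d × Vec d, ‖p‖ ≤ ‖(p.1, p.2.1)‖ + ‖(p.1, p.2.2)‖ := by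
    refine fun p => max_le ?_ (max_le ?_ ?_)
    · exact (norm_fst_le (p.1, p.2.1)).trans (le_add_of_nonneg_right (norm_nonneg _))
    · exact (norm_snd_le (p.1, p.2.1)).trans (le_add_of_nonneg_right (norm_nonneg _))
    · exact (norm_snd_le (p.1, p.2.2)).trans (le_add_of_nonneg_left (norm_nonneg _))
  obtain ⟨α, hα, h1, h2, h3⟩ := (isDualBound_sqDist γ₁ γ₂).exists_measure
    (by fun_prop) (by fun_prop) hnorm
    ((hm γ₁).integrable (by norm_num)).norm ((hm γ₂).integrable (by norm_num)).norm
    (by fun_prop) (fun p => by positivity) hcd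
  have hadm : α ∈ Adm γ₁ γ₂ := mem_adm_of_map_eq h1 h2
  refine ⟨α, hadm, le_antisymm (wRho_sq_le_of_mem_adm hadm) ?_⟩
  rw [ofReal_sqDist] at h3
  refine (lintegral_mono fun p => ?_).trans h3
  rw [ENNReal.ofReal_pow (norm_nonneg _), ofReal_norm]

/-! ### Jensen's inequality and conditional means. -/

theorem eLpNorm_two_sq {Ω F : Type*} [MeasurableSpace Ω] {P : Measure Ω}
    [NormedAddCommGroup F] (f : Ω → F) : eLpNorm f 2 P ^ 2 = ∫⁻ ω, ‖f ω‖ₑ ^ 2 ∂P := by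
  have := eLpNorm_nnreal_pow_eq_lintegral (μ := P) (f := f) (p := 2) (by norm_num)
  simpa using this

/-- Jensen's inequality for the squared distance to a point. -/
theorem enorm_integral_sub_sq_le {Ω F : Type*} [MeasurableSpace Ω] {P : Measure Ω}
    [IsProbabilityMeasure P] [NormedAddCommGroup F] [NormedSpace ℝ F] [CompleteSpace F]
    {f : Ω → F} (hf : Integrable f P) (b : F) :
    ‖∫ ω, f ω ∂P - b‖ₑ ^ 2 ≤ ∫⁻ ω, ‖f ω - b‖ₑ ^ 2 ∂P := by
  have h : ∫ ω, f ω ∂P - b = ∫ ω, (f ω - b) ∂P := by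
    rw [integral_sub hf (integrable_const b)]
    simp
  rw [h, ← eLpNorm_two_sq]
  gcongr
  refine (enorm_integral_le_lintegral_enorm _).trans ?_
  rw [← eLpNorm_one_eq_lintegral_enorm]
  exact eLpNorm_le_eLpNorm_of_exponent_le (by norm_num) (hf.1.sub aestronglyMeasurable_const)

section ConditionalMean

variable {A E : Type*} [MeasurableSpace A] [NormedAddCommGroup E] [NormedSpace ℝ E]
  [CompleteSpace E] [MeasurableSpace E] [BorelSpace E] [SecondCountableTopology E]

/-- The mean of the second component conditionally on the first one. -/
def condMean (μ : Measure (A × E)) [IsFiniteMeasure μ] (a : A) : E :=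
  ∫ z, z ∂(μ.condKernel a)

variable (μ ν : Measure (A × E)) [IsProbabilityMeasure μ] [IsProbabilityMeasure ν]

theorem measurable_condMean : Measurable (condMean μ) :=
  (stronglyMeasurable_id.integral_kernel).measurable

/-- Replacing one of two conditionally independent variables by its conditional mean decreases
the distance. -/
theorem lintegral_sub_condMean_le (h : μ.fst = ν.fst) (hν : Integrable (fun p => p.2) ν) :
    ∫⁻ p, ‖p.2 - condMean ν p.1‖ₑ ^ 2 ∂μ ≤ ∫⁻ p, ‖p.2.1 - p.2.2‖ₑ ^ 2 ∂(glue μ ν) := by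
  have hm := measurable_condMean ν
  rw [lintegral_glue _ _ (by fun_prop)]
  conv_lhs => rw [← μ.disintegrate μ.condKernel]
  rw [Measure.lintegral_compProd (by fun_prop)]
  rw [← ν.disintegrate ν.condKernel, ← h] at hν
  refine lintegral_mono_ae ?_
  filter_upwards [((Measure.integrable_compProd_iff hν.1).1 hν).1] with a ha
  refine lintegral_mono fun z => ?_
  have := enorm_integral_sub_sq_le ha z
  rw [enorm_sub_rev]
  refine this.trans (lintegral_mono fun z' => ?_)
  rw [enorm_sub_rev]

end ConditionalMean

/-! ### Distances and convexity in terms of random variables. -/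

section RandomVariables

variable {Ω : Type*} [MeasurableSpace Ω] {P : Measure Ω} {X Y Y' U : Ω → Vec d}
  {γ γ₁ γ₂ υ : PRho ρ} {C : Set (PRho ρ)}

theorem wRho_le_eLpNorm (hX : Measurable X) (hY : Measurable Y) (hY' : Measurable Y')
    (h₁ : P.map (fun ω => (X ω, Y ω)) = γ₁.meas) (h₂ : P.map (fun ω => (X ω, Y' ω)) = γ₂.meas) :
    wRho γ₁ γ₂ ≤ eLpNorm (fun ω => Y ω - Y' ω) 2 P := by
  rw [← ENNReal.pow_le_pow_left_iff (two_ne_zero), eLpNorm_two_sq]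
  have := wRho_sq_le_of_mem_adm ((map_mem_adm_iff hX hY hY').2 ⟨h₁, h₂⟩)
  rwa [lintegral_map (by fun_prop) (by fun_prop)] at this

theorem sqDist_le_integral (hX : Measurable X) (hY : Measurable Y) (hY' : Measurable Y')
    (h₁ : P.map (fun ω => (X ω, Y ω)) = γ₁.meas) (h₂ : P.map (fun ω => (X ω, Y' ω)) = γ₂.meas) :
    sqDist γ₁ γ₂ ≤ ∫ ω, ‖Y ω - Y' ω‖ ^ 2 ∂P := by
  have h := wRho_le_eLpNorm hX hY hY' h₁ h₂
  have hm : MemLp (fun ω => Y ω - Y' ω) 2 P :=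
    (PRho.memLp_of_map_eq hX hY h₁).2.sub (PRho.memLp_of_map_eq hX hY' h₂).2
  rw [← ENNReal.pow_le_pow_left_iff (two_ne_zero), eLpNorm_two_sq, lintegral_enorm_sq hm,
    ← ofReal_sqDist] at h
  exact (ENNReal.ofReal_le_ofReal_iff (integral_nonneg fun ω => by positivity)).1 h

theorem integral_eq_sqDist_of_mem_opt (hX : Measurable X) (hY : Measurable Y)
    (hY' : Measurable Y') (h : P.map (fun ω => (X ω, Y ω, Y' ω)) ∈ Opt γ₁ γ₂) :
    ∫ ω, ‖Y ω - Y' ω‖ ^ 2 ∂P = sqDist γ₁ γ₂ := by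
  obtain ⟨h1, h2⟩ := (map_mem_adm_iff hX hY hY').1 h.1
  have hm : MemLp (fun ω => Y ω - Y' ω) 2 P :=
    (PRho.memLp_of_map_eq hX hY h1).2.sub (PRho.memLp_of_map_eq hX hY' h2).2
  have h3 := h.2
  rw [lintegral_map (by fun_prop) (by fun_prop), lintegral_enorm_sq hm] at h3
  rw [sqDist, h3, ENNReal.toReal_ofReal (integral_nonneg fun ω => by positivity)]

theorem PRho.map_eq_base (hX : Measurable X) (hY : Measurable Y)
    (h : P.map (fun ω => (X ω, Y ω)) = γ.meas) : P.map X = ρ := by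
  rw [← γ.map_fst_meas, ← h, Measure.map_map (by fun_prop) (by fun_prop)]
  rfl

theorem PRho.exists_of_memLp [IsProbabilityMeasure P] (hX : Measurable X) (hY : Measurable Y)
    (h : P.map X = ρ) (hX2 : MemLp X 2 P) (hY2 : MemLp Y 2 P) :
    ∃ γ : PRho ρ, P.map (fun ω => (X ω, Y ω)) = γ.meas := by
  refine ⟨⟨P.map (fun ω => (X ω, Y ω)), ?_, ?_⟩, rfl⟩
  · rw [isP2_map_iff (by fun_prop), memLp_prod_iff]
    exact ⟨hX2, hY2⟩
  · rw [Measure.map_map (by fun_prop) (by fun_prop)]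
    exact h

/-- Convexity quantifies over all admissible plans, so no optimality of the joint law of `(X, Y,
Y')` is needed. -/
theorem IsClosedConvex.exists_convex_comb (hC : IsClosedConvex C) (hγ₁ : γ₁ ∈ C) (hγ₂ : γ₂ ∈ C)
    (hX : Measurable X) (hY : Measurable Y) (hY' : Measurable Y')
    (h₁ : P.map (fun ω => (X ω, Y ω)) = γ₁.meas) (h₂ : P.map (fun ω => (X ω, Y' ω)) = γ₂.meas)
    {s : ℝ} (hs : s ∈ Set.Icc (0 : ℝ) 1) :
    ∃ η ∈ C, P.map (fun ω => (X ω, (1 - s) • Y ω + s • Y' ω)) = η.meas := by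
  have hP := PRho.isProbabilityMeasure_of_map_eq hX hY h₁
  obtain ⟨hX2, hY2⟩ := PRho.memLp_of_map_eq hX hY h₁
  have hY2' := (PRho.memLp_of_map_eq hX hY' h₂).2
  obtain ⟨η, hη⟩ := PRho.exists_of_memLp (ρ := ρ) (P := P) hX
    (Y := fun ω => (1 - s) • Y ω + s • Y' ω) (by fun_prop) (PRho.map_eq_base hX hY h₁) hX2
    ((hY2.const_smul (1 - s)).add (hY2'.const_smul s))
  refine ⟨η, hC.convex γ₁ hγ₁ γ₂ hγ₂ s hs
    ⟨P.map (fun ω => (X ω, (1 - s) • Y ω, s • Y' ω)), ?_, ?_⟩, hη⟩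
  · rw [map_mem_adm_iff hX (by fun_prop) (by fun_prop)]
    constructor
    · change _ = γ₁.meas.map _
      rw [← h₁, Measure.map_map (by fun_prop) (by fun_prop)]
      rfl
    · change _ = γ₂.meas.map _
      rw [← h₂, Measure.map_map (by fun_prop) (by fun_prop)]
      rfl
  · rw [← hη, Measure.map_map (by fun_prop) (by fun_prop)]
    rfl

/-- Convex combinations in `C` are not closer to `υ` than `C` is. -/
theorem IsClosedConvex.le_integral_convex_comb (hC : IsClosedConvex C) (hγ₁ : γ₁ ∈ C)
    (hγ₂ : γ₂ ∈ C) (hX : Measurable X) (hU : Measurable U) (hY : Measurable Y)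
    (hY' : Measurable Y') (hu : P.map (fun ω => (X ω, U ω)) = υ.meas)
    (h₁ : P.map (fun ω => (X ω, Y ω)) = γ₁.meas) (h₂ : P.map (fun ω => (X ω, Y' ω)) = γ₂.meas)
    {m : ℝ} (hm : ∀ η ∈ C, m ≤ sqDist υ η) {s : ℝ} (hs : s ∈ Set.Icc (0 : ℝ) 1) :
    m ≤ ∫ ω, ‖U ω - ((1 - s) • Y ω + s • Y' ω)‖ ^ 2 ∂P := by
  obtain ⟨η, hη, h⟩ := hC.exists_convex_comb hγ₁ hγ₂ hX hY hY' h₁ h₂ hs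
  exact (hm η hη).trans (sqDist_le_integral hX hU (by fun_prop) hu h)

theorem integrable_norm_sq_sub {F : Type*} [NormedAddCommGroup F] {V W : Ω → F}
    (hV : MemLp V 2 P) (hW : MemLp W 2 P) : Integrable (fun ω => ‖V ω - W ω‖ ^ 2) P :=
  (memLp_two_iff_integrable_sq_norm (hV.sub hW).1).1 (hV.sub hW)

/-- The parallelogram estimate for two elements of `C`. -/
theorem IsClosedConvex.integral_sq_sub_le (hC : IsClosedConvex C) (hγ₁ : γ₁ ∈ C)
    (hγ₂ : γ₂ ∈ C) (hX : Measurable X) (hU : Measurable U) (hY : Measurable Y)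
    (hY' : Measurable Y') (hu : P.map (fun ω => (X ω, U ω)) = υ.meas)
    (h₁ : P.map (fun ω => (X ω, Y ω)) = γ₁.meas) (h₂ : P.map (fun ω => (X ω, Y' ω)) = γ₂.meas)
    {m : ℝ} (hm : ∀ η ∈ C, m ≤ sqDist υ η) :
    ∫ ω, ‖Y ω - Y' ω‖ ^ 2 ∂P ≤
      2 * ∫ ω, ‖U ω - Y ω‖ ^ 2 ∂P + 2 * ∫ ω, ‖U ω - Y' ω‖ ^ 2 ∂P - 4 * m := by
  have hU2 := (PRho.memLp_of_map_eq hX hU hu).2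
  have hY2 := (PRho.memLp_of_map_eq hX hY h₁).2
  have hY2' := (PRho.memLp_of_map_eq hX hY' h₂).2
  have hle := hC.le_integral_convex_comb hγ₁ hγ₂ hX hU hY hY' hu h₁ h₂ hm
    (s := 1 / 2) ⟨by norm_num, by norm_num⟩
  have hpt : ∀ ω, ‖U ω - ((1 - (1 / 2 : ℝ)) • Y ω + (1 / 2 : ℝ) • Y' ω)‖ ^ 2 =
      (2 * ‖U ω - Y ω‖ ^ 2 + 2 * ‖U ω - Y' ω‖ ^ 2 - ‖Y ω - Y' ω‖ ^ 2) * (1 / 4) := by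
    intro ω
    have h1 := parallelogram_law_with_norm ℝ (U ω - Y ω) (U ω - Y' ω)
    have h2 : U ω - Y ω + (U ω - Y' ω) =
        (2 : ℝ) • (U ω - ((1 - (1 / 2 : ℝ)) • Y ω + (1 / 2 : ℝ) • Y' ω)) := by
      module
    have h3 : U ω - Y ω - (U ω - Y' ω) = -(Y ω - Y' ω) := by abel
    rw [h2, h3, norm_neg, norm_smul, Real.norm_of_nonneg (by norm_num)] at h1
    linarith
  simp only [hpt] at hle
  rw [integral_mul_const, integral_sub, integral_add, integral_const_mul, integral_const_mul]
    at hle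
  · linarith
  · exact (integrable_norm_sq_sub hU2 hY2).const_mul 2
  · exact (integrable_norm_sq_sub hU2 hY2').const_mul 2
  · exact ((integrable_norm_sq_sub hU2 hY2).const_mul 2).add
      ((integrable_norm_sq_sub hU2 hY2').const_mul 2)
  · exact integrable_norm_sq_sub hY2 hY2'

end RandomVariables

/-! ### Existence of a closest point. -/

variable {C : Set (PRho ρ)} {υ : PRho ρ}

/-- An optimal plan is regrouped as `((x, u), z)`, so that disintegration and gluing take place over
the pair `(x, u)` distributed as `υ`. -/
theorem exists_optimal_extension (υ η : PRho ρ) :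
    ∃ a : Measure ((Vec d × Vec d) × Vec d), IsProbabilityMeasure a ∧ a.fst = υ.meas ∧
      a.map (fun p => (p.1.1, p.2)) = η.meas ∧ ∫ p, ‖p.1.2 - p.2‖ ^ 2 ∂a = sqDist υ η := by
  obtain ⟨α, hα⟩ := exists_mem_opt υ η
  have hprob := hα.1.1.prob
  have hm : Measurable (fun p : Vec d × Vec d × Vec d => ((p.1, p.2.1), p.2.2)) := by fun_prop
  refine ⟨α.map (fun p => ((p.1, p.2.1), p.2.2)),
    Measure.isProbabilityMeasure_map hm.aemeasurable, ?_, ?_, ?_⟩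
  · rw [Measure.fst, Measure.map_map (by fun_prop) (by fun_prop)]
    exact hα.1.2.1
  · rw [Measure.map_map (by fun_prop) (by fun_prop)]
    exact hα.1.2.2
  · rw [integral_map (by fun_prop) (by fun_prop)]
    refine integral_eq_sqDist_of_mem_opt (P := α) (X := fun p => p.1) (Y := fun p => p.2.1)
      (Y' := fun p => p.2.2) (by fun_prop) (by fun_prop) (by fun_prop) ?_
    simpa using hα

/-- Near-minimizers have conditional means close to each other. -/
theorem IsClosedConvex.eLpNorm_sub_condMean_le (hC : IsClosedConvex C)
    {m : ℝ} (hm : ∀ η ∈ C, m ≤ sqDist υ η) {η η' : PRho ρ} (hη : η ∈ C) (hη' : η' ∈ C)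
    {a b : Measure ((Vec d × Vec d) × Vec d)} [IsProbabilityMeasure a] [IsProbabilityMeasure b]
    (ha : a.fst = υ.meas) (hb : b.fst = υ.meas) (ha' : a.map (fun p => (p.1.1, p.2)) = η.meas)
    (hb' : b.map (fun p => (p.1.1, p.2)) = η'.meas) {ε : ℝ} (hε : 0 ≤ ε)
    (hεa : ∫ p, ‖p.1.2 - p.2‖ ^ 2 ∂a ≤ m + ε ^ 2) (hεb : ∫ p, ‖p.1.2 - p.2‖ ^ 2 ∂b ≤ m + ε ^ 2) :
    eLpNorm (fun p => p.2 - condMean b p.1) 2 a ≤ ENNReal.ofReal (2 * ε) := by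
  have hb2 : MemLp (fun p : (Vec d × Vec d) × Vec d => p.2) 2 b :=
    (PRho.memLp_of_map_eq (X := fun p : (Vec d × Vec d) × Vec d => p.1.1) (by fun_prop)
      (by fun_prop) hb').2
  have hl := map_left_glue a b
  have hr := map_right_glue a b (ha.trans hb.symm)
  have hX1 : (glue a b).map (fun p => (p.1.1, p.1.2)) = υ.meas := by
    rw [← ha, Measure.fst]
    conv_rhs => rw [← hl]
    rw [Measure.map_map (by fun_prop) (by fun_prop)]
    rfl
  have hX2 : (glue a b).map (fun p => (p.1.1, p.2.1)) = η.meas := by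
    rw [← ha']
    conv_rhs => rw [← hl]
    rw [Measure.map_map (by fun_prop) (by fun_prop)]
    rfl
  have hX3 : (glue a b).map (fun p => (p.1.1, p.2.2)) = η'.meas := by
    rw [← hb']
    conv_rhs => rw [← hr]
    rw [Measure.map_map (by fun_prop) (by fun_prop)]
    rfl
  have hpar := hC.integral_sq_sub_le hη hη' (P := glue a b) (X := fun p => p.1.1) (U := fun p => p.1.2)
    (Y := fun p => p.2.1) (Y' := fun p => p.2.2) (by fun_prop) (by fun_prop) (by fun_prop)
    (by fun_prop) hX1 hX2 hX3 hm
  have hia : ∫ p, ‖p.1.2 - p.2.1‖ ^ 2 ∂(glue a b) = ∫ p, ‖p.1.2 - p.2‖ ^ 2 ∂a := by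
    conv_rhs => rw [← hl]
    rw [integral_map (by fun_prop) (by fun_prop)]
  have hib : ∫ p, ‖p.1.2 - p.2.2‖ ^ 2 ∂(glue a b) = ∫ p, ‖p.1.2 - p.2‖ ^ 2 ∂b := by
    conv_rhs => rw [← hr]
    rw [integral_map (by fun_prop) (by fun_prop)]
  rw [hia, hib] at hpar
  rw [← ENNReal.pow_le_pow_left_iff (two_ne_zero), eLpNorm_two_sq]
  refine (lintegral_sub_condMean_le a b (ha.trans hb.symm)
    (hb2.integrable (by norm_num))).trans ?_
  have hm2 : MemLp (fun p : (Vec d × Vec d) × Vec d × Vec d => p.2.1 - p.2.2) 2 (glue a b) :=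
    (PRho.memLp_of_map_eq (X := fun p : (Vec d × Vec d) × Vec d × Vec d => p.1.1) (by fun_prop)
      (by fun_prop) hX2).2.sub
    (PRho.memLp_of_map_eq (X := fun p : (Vec d × Vec d) × Vec d × Vec d => p.1.1) (by fun_prop)
      (by fun_prop) hX3).2
  rw [lintegral_enorm_sq hm2, ← ENNReal.ofReal_pow (by positivity)]
  -- The parallelogram estimate gives `2(m + ε²) + 2(m + ε²) - 4m = (2ε)²`.
  refine ENNReal.ofReal_le_ofReal ?_
  linarith

/-- Completeness of `L²(υ)` replaces compactness: the conditional means of a minimizing sequence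
converge, and each near-minimizer is close to the image of `υ` under its conditional mean. -/
theorem IsClosedConvex.exists_isClosestPoint (hC : IsClosedConvex C) (υ : PRho ρ) :
    ∃ π, IsClosestPoint C υ π := by
  set S : Set ℝ := sqDist υ '' C
  have hne : S.Nonempty := hC.nonempty.image _
  have hbdd : BddBelow S := ⟨0, by rintro _ ⟨η, -, rfl⟩; exact sqDist_nonneg _ _⟩
  have hm : ∀ η ∈ C, sInf S ≤ sqDist υ η := fun η hη => csInf_le hbdd ⟨η, hη, rfl⟩
  -- Geometric decay makes the Cauchy bounds summable; the excess is measured by `ε k ^ 2` because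
  -- distances are controlled by its square root.
  set ε : ℕ → ℝ := fun k => (1 / 2) ^ k
  have hε : ∀ k, 0 < ε k := fun k => by positivity
  have hseq : ∀ k, ∃ η ∈ C, sqDist υ η ≤ sInf S + ε k ^ 2 := by
    intro k
    obtain ⟨_, ⟨η, hη, rfl⟩, h⟩ := exists_lt_of_csInf_lt hne
      (lt_add_of_pos_right (sInf S) (pow_pos (hε k) 2))
    exact ⟨η, hη, h.le⟩
  choose η hη hηε using hseq
  choose a hprob ha1 ha2 ha3 using fun k => exists_optimal_extension υ (η k)
  have hz : ∀ k, MemLp (fun p : (Vec d × Vec d) × Vec d => p.2) 2 (a k) := fun k =>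
    (PRho.memLp_of_map_eq (X := fun p : (Vec d × Vec d) × Vec d => p.1.1) (by fun_prop)
      (by fun_prop) (ha2 k)).2
  have hclose : ∀ N k l, N ≤ k → N ≤ l →
      eLpNorm (fun p => p.2 - condMean (a l) p.1) 2 (a k) ≤ ENNReal.ofReal (2 * ε N) := by
    intro N k l hk hl
    have hle : ∀ j, N ≤ j → ε j ^ 2 ≤ ε N ^ 2 := fun j hj => by
      have : ε j ≤ ε N := pow_le_pow_of_le_one (by norm_num) (by norm_num) hj
      exact pow_le_pow_left₀ (hε j).le this 2
    refine hC.eLpNorm_sub_condMean_le hm (hη k) (hη l) (ha1 k) (ha1 l) (ha2 k) (ha2 l)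
      (hε N).le ?_ ?_
    · rw [ha3]
      linarith [hηε k, hle k hk]
    · rw [ha3]
      linarith [hηε l, hle l hl]
  have hmeas : ∀ k, Measurable (condMean (a k)) := fun k => measurable_condMean (a k)
  -- norms in `L²(υ)` can be computed in `L²(a k)`
  have hpull : ∀ (k : ℕ) (g : Vec d × Vec d → Vec d), AEStronglyMeasurable g υ.meas →
      eLpNorm (fun p => g p.1) 2 (a k) = eLpNorm g 2 υ.meas := by
    intro k g hg
    rw [← ha1 k] at hg ⊢
    exact (eLpNorm_map_measure hg measurable_fst.aemeasurable).symm
  have hTmem : ∀ k, MemLp (condMean (a k)) 2 υ.meas := by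
    intro k
    refine ⟨(hmeas k).aestronglyMeasurable, ?_⟩
    rw [← hpull k _ (hmeas k).aestronglyMeasurable]
    have hmk := hmeas k
    -- The estimate with both indices equal bounds the distance of a near-minimizer from its own
    -- conditional mean.
    have h1 : MemLp (fun p => p.2 - condMean (a k) p.1) 2 (a k) :=
      ⟨by fun_prop, (hclose k k k le_rfl le_rfl).trans_lt ENNReal.ofReal_lt_top⟩
    have h2 := (hz k).sub h1
    have h3 : ((fun p : (Vec d × Vec d) × Vec d => p.2) - fun p => p.2 - condMean (a k) p.1) =
        fun p => condMean (a k) p.1 := by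
      ext1 p
      simp
    rw [h3] at h2
    exact h2.2
  obtain ⟨T₀, hT₀, hlim₀⟩ := Lp.cauchy_complete_eLpNorm (by norm_num) hTmem
    -- The triangle inequality gives `2ε + 2ε`; the constant `5` makes the inequality strict.
    (B := fun N => ENNReal.ofReal (5 * ε N)) (by
      rw [← ENNReal.ofReal_tsum_of_nonneg (fun n => by have := hε n; positivity)
        (summable_geometric_two.mul_left 5)]
      exact ENNReal.ofReal_ne_top) (by
      intro N k l hk hl
      have hmk := hmeas k
      have hml := hmeas l
      rw [← hpull k _ (by fun_prop)]
      have h1 : (fun p : (Vec d × Vec d) × Vec d => (condMean (a k) - condMean (a l)) p.1) =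
          (fun p => p.2 - condMean (a l) p.1) - fun p => p.2 - condMean (a k) p.1 := by
        ext1 p
        simp
      rw [h1]
      refine (eLpNorm_sub_le (by fun_prop) (by fun_prop) (by norm_num)).trans_lt ?_
      refine (add_le_add (hclose N k l hk hl) (hclose N k k hk hk)).trans_lt ?_
      rw [← ENNReal.ofReal_add (by have := hε N; positivity) (by have := hε N; positivity)]
      refine (ENNReal.ofReal_lt_ofReal_iff (by have := hε N; positivity)).2 ?_
      linarith [hε N])
  set T := hT₀.1.mk T₀
  have hTm : Measurable T := hT₀.1.stronglyMeasurable_mk.measurable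
  have hT : MemLp T 2 υ.meas := (memLp_congr_ae hT₀.1.ae_eq_mk).1 hT₀
  have hlim : Tendsto (fun k => eLpNorm (condMean (a k) - T) 2 υ.meas) atTop (𝓝 0) := by
    refine hlim₀.congr fun k => eLpNorm_congr_ae ?_
    filter_upwards [hT₀.1.ae_eq_mk] with q hq
    simp only [Pi.sub_apply]
    rw [hq]
  obtain ⟨π, hπ⟩ := PRho.exists_of_memLp (ρ := ρ) (P := υ.meas) measurable_fst hTm
    υ.map_fst_meas (isP2_iff.1 υ.isP2_meas).2.fst hT
  have hπk : ∀ k, (a k).map (fun p => (p.1.1, T p.1)) = π.meas := by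
    intro k
    rw [← hπ, ← ha1 k, Measure.fst, Measure.map_map (by fun_prop) (by fun_prop)]
    rfl
  have hυk : ∀ k, (a k).map (fun p => (p.1.1, p.1.2)) = υ.meas := ha1
  set δ : ℕ → ℝ≥0∞ := fun k => ENNReal.ofReal (2 * ε k) + eLpNorm (condMean (a k) - T) 2 υ.meas
  have hε0 : Tendsto ε atTop (𝓝 0) :=
    tendsto_pow_atTop_nhds_zero_of_lt_one (by norm_num) (by norm_num)
  have hδ : Tendsto δ atTop (𝓝 0) := by
    have h1 : Tendsto (fun k => ENNReal.ofReal (2 * ε k)) atTop (𝓝 0) := by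
      simpa using ENNReal.tendsto_ofReal (hε0.const_mul 2)
    have h2 := h1.add hlim
    rwa [add_zero] at h2
  have hdist : ∀ k, eLpNorm (fun p => p.2 - T p.1) 2 (a k) ≤ δ k := by
    intro k
    have hmk := hmeas k
    have h1 : (fun p : (Vec d × Vec d) × Vec d => p.2 - T p.1) =
        (fun p => p.2 - condMean (a k) p.1) + fun p => (condMean (a k) - T) p.1 := by
      ext1 p
      simp
    rw [h1]
    refine (eLpNorm_add_le (by fun_prop)
      ((hmk.sub hTm).comp measurable_fst).aestronglyMeasurable (by norm_num)).trans ?_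
    exact add_le_add (hclose k k k le_rfl le_rfl) (hpull k _ (by fun_prop)).le
  refine ⟨π, hC.closed η π hη ?_, fun ζ hζ => ?_⟩
  · refine tendsto_of_tendsto_of_tendsto_of_le_of_le tendsto_const_nhds hδ (fun _ => zero_le)
      fun k => ?_
    exact (wRho_le_eLpNorm (X := fun p : (Vec d × Vec d) × Vec d => p.1.1) (by fun_prop)
      (by fun_prop) (by fun_prop) (ha2 k) (hπk k)).trans (hdist k)
  · have hk : ∀ k, wRho υ π ≤ (wRho υ ζ + ENNReal.ofReal (ε k)) + δ k := by
      intro k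
      refine (wRho_le_eLpNorm (X := fun p : (Vec d × Vec d) × Vec d => p.1.1) (by fun_prop)
        (by fun_prop) (by fun_prop) (hυk k) (hπk k)).trans ?_
      have h1 : (fun p : (Vec d × Vec d) × Vec d => p.1.2 - T p.1) =
          (fun p => p.1.2 - p.2) + fun p => p.2 - T p.1 := by
        ext1 p
        simp
      rw [h1]
      refine (eLpNorm_add_le (by fun_prop) (by fun_prop) (by norm_num)).trans ?_
      refine add_le_add ?_ (hdist k)
      have hmem : MemLp (fun p : (Vec d × Vec d) × Vec d => p.1.2 - p.2) 2 (a k) :=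
        (PRho.memLp_of_map_eq (X := fun p : (Vec d × Vec d) × Vec d => p.1.1) (by fun_prop)
          (by fun_prop) (hυk k)).2.sub (hz k)
      rw [← ENNReal.pow_le_pow_left_iff (two_ne_zero), eLpNorm_two_sq, lintegral_enorm_sq hmem,
        ha3]
      -- The squared bound `D² + ε²` is relaxed to `(D + ε)²`, which passes to the limit after
      -- taking roots.
      calc ENNReal.ofReal (sqDist υ (η k)) ≤ ENNReal.ofReal (sqDist υ ζ + ε k ^ 2) :=
            ENNReal.ofReal_le_ofReal ((hηε k).trans (by linarith [hm ζ hζ]))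
        _ = wRho υ ζ ^ 2 + ENNReal.ofReal (ε k) ^ 2 := by
            rw [ENNReal.ofReal_add (sqDist_nonneg _ _) (by positivity), ofReal_sqDist,
              ENNReal.ofReal_pow (hε k).le]
        _ ≤ wRho υ ζ ^ 2 + ENNReal.ofReal (ε k) ^ 2 + 2 * wRho υ ζ * ENNReal.ofReal (ε k) :=
            le_self_add
        _ = (wRho υ ζ + ENNReal.ofReal (ε k)) ^ 2 := by ring
    have h1 : Tendsto (fun k => ENNReal.ofReal (ε k)) atTop (𝓝 0) := by
      simpa using ENNReal.tendsto_ofReal hε0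
    have h2 := (tendsto_const_nhds (x := wRho υ ζ)).add h1 |>.add hδ
    rw [add_zero, add_zero] at h2
    exact ge_of_tendsto' h2 hk

/-! ### Quadratic identities in `L²`. -/

section Integrals

variable {Ω : Type*} [MeasurableSpace Ω] {P : Measure Ω} {F : Type*} [NormedAddCommGroup F]
  [InnerProductSpace ℝ F] {U V W Y Y' : Ω → F}

theorem integrable_inner_of_memLp_two (hV : MemLp V 2 P) (hW : MemLp W 2 P) :
    Integrable (fun ω => inner ℝ (V ω) (W ω)) P := by
  have h : (fun ω => inner ℝ (V ω) (W ω)) =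
      fun ω => (‖V ω‖ ^ 2 + ‖W ω‖ ^ 2 - ‖V ω - W ω‖ ^ 2) / 2 := by
    ext1 ω
    rw [norm_sub_sq_real]
    ring
  rw [h]
  exact ((((memLp_two_iff_integrable_sq_norm hV.1).1 hV).add
    ((memLp_two_iff_integrable_sq_norm hW.1).1 hW)).sub
    (integrable_norm_sq_sub hV hW)).div_const 2

theorem integral_norm_sq_sub_convex_comb (hU : MemLp U 2 P) (hY : MemLp Y 2 P)
    (hY' : MemLp Y' 2 P) (s : ℝ) :
    ∫ ω, ‖U ω - ((1 - s) • Y ω + s • Y' ω)‖ ^ 2 ∂P = ∫ ω, ‖U ω - Y ω‖ ^ 2 ∂P +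
      2 * s * ∫ ω, inner ℝ (U ω - Y ω) (Y ω - Y' ω) ∂P + s ^ 2 * ∫ ω, ‖Y ω - Y' ω‖ ^ 2 ∂P := by
  have h1 := integrable_norm_sq_sub hU hY
  have h2 : Integrable (fun ω => 2 * s * inner ℝ (U ω - Y ω) (Y ω - Y' ω)) P :=
    (integrable_inner_of_memLp_two (hU.sub hY) (hY.sub hY')).const_mul (2 * s)
  have h3 := (integrable_norm_sq_sub hY hY').const_mul (s ^ 2)
  have h12 : Integrable (fun ω => ‖U ω - Y ω‖ ^ 2 + 2 * s * inner ℝ (U ω - Y ω) (Y ω - Y' ω)) P :=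
    h1.add h2
  rw [← integral_const_mul, ← integral_const_mul, ← integral_add h1 h2, ← integral_add h12 h3]
  refine integral_congr_ae (ae_of_all _ fun ω => ?_)
  have h : U ω - ((1 - s) • Y ω + s • Y' ω) = (U ω - Y ω) + s • (Y ω - Y' ω) := by module
  simp only
  rw [h, norm_add_sq_real, norm_smul, mul_pow, inner_smul_right, Real.norm_eq_abs, sq_abs]
  ring

/-- Two obtuse angle inequalities give a contraction. -/
theorem integral_norm_sq_sub_le_of_inner_nonneg {Y₁ Y₂ Y₃ Y₄ : Ω → F} (h₁ : MemLp Y₁ 2 P)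
    (h₂ : MemLp Y₂ 2 P) (h₃ : MemLp Y₃ 2 P) (h₄ : MemLp Y₄ 2 P)
    (h : 0 ≤ ∫ ω, inner ℝ (Y₁ ω - Y₂ ω) (Y₂ ω - Y₄ ω) ∂P)
    (h' : 0 ≤ ∫ ω, inner ℝ (Y₃ ω - Y₄ ω) (Y₄ ω - Y₂ ω) ∂P) :
    ∫ ω, ‖Y₂ ω - Y₄ ω‖ ^ 2 ∂P ≤ ∫ ω, ‖Y₁ ω - Y₃ ω‖ ^ 2 ∂P := by
  have hi := integrable_inner_of_memLp_two (h₁.sub h₂) (h₂.sub h₄)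
  have hi' := integrable_inner_of_memLp_two (h₃.sub h₄) (h₄.sub h₂)
  have hsum := integral_add hi hi'
  have hle : ∫ ω, (inner ℝ ((Y₁ - Y₂) ω) ((Y₂ - Y₄) ω) + inner ℝ ((Y₃ - Y₄) ω) ((Y₄ - Y₂) ω)) ∂P
      ≤ ∫ ω, (‖Y₁ ω - Y₃ ω‖ ^ 2 - ‖Y₂ ω - Y₄ ω‖ ^ 2) / 2 ∂P := by
    refine integral_mono (hi.add hi')
      (((integrable_norm_sq_sub h₁ h₃).sub (integrable_norm_sq_sub h₂ h₄)).div_const 2)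
      fun ω => ?_
    simp only [Pi.sub_apply]
    have h5 : inner ℝ (Y₁ ω - Y₂ ω) (Y₂ ω - Y₄ ω) + inner ℝ (Y₃ ω - Y₄ ω) (Y₄ ω - Y₂ ω) =
        inner ℝ (Y₁ ω - Y₃ ω) (Y₂ ω - Y₄ ω) - ‖Y₂ ω - Y₄ ω‖ ^ 2 := by
      rw [← real_inner_self_eq_norm_sq, ← neg_sub (Y₂ ω) (Y₄ ω), inner_neg_right, ← sub_eq_add_neg,
        ← inner_sub_left, ← inner_sub_left]
      congr 1
      abel
    have h6 := norm_sub_sq_real (Y₁ ω - Y₃ ω) (Y₂ ω - Y₄ ω)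
    have h7 := sq_nonneg ‖Y₁ ω - Y₃ ω - (Y₂ ω - Y₄ ω)‖
    rw [h5]
    linarith
  rw [integral_div, integral_sub (integrable_norm_sq_sub h₁ h₃) (integrable_norm_sq_sub h₂ h₄)]
    at hle
  simp only [Pi.sub_apply] at hsum hle
  linarith

end Integrals

/-! ### Uniqueness, the obtuse angle inequality and its converse. -/

variable {π : PRho ρ}

theorem IsClosestPoint.sqDist_le (hπ : IsClosestPoint C υ π) {η : PRho ρ} (hη : η ∈ C) :
    sqDist υ π ≤ sqDist υ η :=
  sqDist_le_sqDist_iff.2 (hπ.2 η hη)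

/-- With `ε = 0`, optimal plans to `π'` and to `π` are both concentrated on the graph of the
conditional mean of the latter. So both measures are the image of `υ` under the same map. -/
theorem IsClosestPoint.unique (hC : IsClosedConvex C) (hπ : IsClosestPoint C υ π) {π' : PRho ρ}
    (hπ' : IsClosestPoint C υ π') : π' = π := by
  obtain ⟨a, ha, ha1, ha2, ha3⟩ := exists_optimal_extension υ π
  obtain ⟨b, hb, hb1, hb2, hb3⟩ := exists_optimal_extension υ π'
  have hle := hC.eLpNorm_sub_condMean_le (fun η hη => hπ.sqDist_le hη) hπ'.1 hπ.1 hb1 ha1 hb2 ha2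
    le_rfl (by rw [hb3]; simpa using hπ'.sqDist_le hπ.1) (by rw [ha3]; simp)
  have hle' := hC.eLpNorm_sub_condMean_le (fun η hη => hπ.sqDist_le hη) hπ.1 hπ.1 ha1 ha1 ha2 ha2
    le_rfl (by rw [ha3]; simp) (by rw [ha3]; simp)
  have hm := measurable_condMean a
  have key : ∀ (c : Measure ((Vec d × Vec d) × Vec d)) (γ : PRho ρ), c.fst = υ.meas →
      c.map (fun p => (p.1.1, p.2)) = γ.meas →
      eLpNorm (fun p => p.2 - condMean a p.1) 2 c ≤ ENNReal.ofReal (2 * 0) →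
      γ.meas = υ.meas.map (fun q => (q.1, condMean a q)) := by
    intro c γ h1 h2 h3
    rw [mul_zero, ENNReal.ofReal_zero, nonpos_iff_eq_zero,
      eLpNorm_eq_zero_iff (by fun_prop) (by norm_num)] at h3
    rw [← h1, ← h2, Measure.fst, Measure.map_map (by fun_prop) (by fun_prop)]
    refine Measure.map_congr ?_
    filter_upwards [h3] with p hp
    simp only [Function.comp_apply]
    rw [← sub_eq_zero.1 hp]
  exact PRho.ext_meas ((key b π' hb1 hb2 hle).trans (key a π ha1 ha2 hle').symm)

section RandomVariables

variable {Ω : Type*} [MeasurableSpace Ω] {P : Measure Ω} {X U Y Y' : Ω → Vec d} {η : PRho ρ}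

/-- The quadratic `s ↦ ∫|U - (1-s)Y - sY'|²` attains the minimal value at `s = 0` by optimality of
`(U, Y)` and stays above it on `[0, 1]`. Its derivative at `0` is twice the integral in question. -/
theorem IsClosestPoint.integral_inner_nonneg (hC : IsClosedConvex C) (hπ : IsClosestPoint C υ π)
    (hη : η ∈ C) (hX : Measurable X) (hU : Measurable U) (hY : Measurable Y)
    (hY' : Measurable Y') (hopt : P.map (fun ω => (X ω, U ω, Y ω)) ∈ Opt υ π)
    (h : P.map (fun ω => (X ω, Y' ω)) = η.meas) :
    0 ≤ ∫ ω, inner ℝ (U ω - Y ω) (Y ω - Y' ω) ∂P := by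
  obtain ⟨h1, h2⟩ := (map_mem_adm_iff hX hU hY).1 hopt.1
  have hexp := integral_norm_sq_sub_convex_comb (PRho.memLp_of_map_eq hX hU h1).2
    (PRho.memLp_of_map_eq hX hY h2).2 (PRho.memLp_of_map_eq hX hY' h).2
  have hle := fun (s : ℝ) (hs : s ∈ Set.Icc (0 : ℝ) 1) =>
    hC.le_integral_convex_comb hπ.1 hη hX hU hY hY' h1 h2 h (fun η hη => hπ.sqDist_le hη) hs
  simp only [hexp, integral_eq_sqDist_of_mem_opt hX hU hY hopt] at hle
  have hK : 0 ≤ ∫ ω, ‖Y ω - Y' ω‖ ^ 2 ∂P := integral_nonneg fun ω => by positivity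
  generalize ∫ ω, ‖Y ω - Y' ω‖ ^ 2 ∂P = K at *
  generalize ∫ ω, inner ℝ (U ω - Y ω) (Y ω - Y' ω) ∂P = I at *
  by_contra! hI
  -- The choice `s = -I / (K - I)` is positive and at most `1`, and turns `2I + sK ≥ 0` into `(1 +
  -- s) I ≥ 0`, contradicting `I < 0`.
  have hpos : 0 < K - I := by linarith
  have hs0 : 0 < -I / (K - I) := div_pos (by linarith) hpos
  have hs1 : -I / (K - I) ≤ 1 := (div_le_one hpos).2 (by linarith)
  have hsK : -I / (K - I) * (K - I) = -I := div_mul_cancel₀ _ hpos.ne'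
  have := hle _ ⟨hs0.le, hs1⟩
  generalize -I / (K - I) = s at *
  have h3 : 0 ≤ s * (2 * I + s * K) := by linarith
  have h4 := nonneg_of_mul_nonneg_right h3 hs0
  nlinarith

/-- At `s = 1` the expansion reads `∫|U-Y'|² = ∫|U-Y|² + 2I + ∫|Y-Y'|²`. The left side is the
squared distance to `η` by optimality, and admissibility suffices to bound the first term on the
right from below. -/
theorem sqDist_le_of_integral_inner_nonneg {ζ : PRho ρ} (hX : Measurable X) (hU : Measurable U)
    (hY : Measurable Y) (hY' : Measurable Y')
    (hadm : P.map (fun ω => (X ω, U ω, Y ω)) ∈ Adm υ ζ)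
    (hopt : P.map (fun ω => (X ω, U ω, Y' ω)) ∈ Opt υ η)
    (h : 0 ≤ ∫ ω, inner ℝ (U ω - Y ω) (Y ω - Y' ω) ∂P) : sqDist υ ζ ≤ sqDist υ η := by
  obtain ⟨h1, h2⟩ := (map_mem_adm_iff hX hU hY).1 hadm
  have h3 := ((map_mem_adm_iff hX hU hY').1 hopt.1).2
  have hexp := integral_norm_sq_sub_convex_comb (PRho.memLp_of_map_eq hX hU h1).2
    (PRho.memLp_of_map_eq hX hY h2).2 (PRho.memLp_of_map_eq hX hY' h3).2 1
  simp only [sub_self, zero_smul, one_smul, zero_add,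
    integral_eq_sqDist_of_mem_opt hX hU hY' hopt] at hexp
  have hK : 0 ≤ ∫ ω, ‖Y ω - Y' ω‖ ^ 2 ∂P := integral_nonneg fun ω => by positivity
  linarith [sqDist_le_integral hX hU hY h1 h2]

/-- Each closest point is tested against the other one, which also lies in `C`; the joint law of the
two pairs is otherwise arbitrary. -/
theorem IsClosestPoint.lintegral_sq_sub_le (hC : IsClosedConvex C) {υ₁ υ₂ π₁ π₂ : PRho ρ}
    (hπ₁ : IsClosestPoint C υ₁ π₁) (hπ₂ : IsClosestPoint C υ₂ π₂) {Y₁ Y₂ Y₃ Y₄ : Ω → Vec d}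
    (hX : Measurable X) (hY₁ : Measurable Y₁) (hY₂ : Measurable Y₂) (hY₃ : Measurable Y₃)
    (hY₄ : Measurable Y₄) (h₁ : P.map (fun ω => (X ω, Y₁ ω, Y₂ ω)) ∈ Opt υ₁ π₁)
    (h₂ : P.map (fun ω => (X ω, Y₃ ω, Y₄ ω)) ∈ Opt υ₂ π₂) :
    ∫⁻ ω, ‖Y₂ ω - Y₄ ω‖ₑ ^ 2 ∂P ≤ ∫⁻ ω, ‖Y₁ ω - Y₃ ω‖ₑ ^ 2 ∂P := by
  obtain ⟨a1, a2⟩ := (map_mem_adm_iff hX hY₁ hY₂).1 h₁.1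
  obtain ⟨a3, a4⟩ := (map_mem_adm_iff hX hY₃ hY₄).1 h₂.1
  have m1 := (PRho.memLp_of_map_eq hX hY₁ a1).2
  have m2 := (PRho.memLp_of_map_eq hX hY₂ a2).2
  have m3 := (PRho.memLp_of_map_eq hX hY₃ a3).2
  have m4 := (PRho.memLp_of_map_eq hX hY₄ a4).2
  rw [lintegral_enorm_sq (f := fun ω => Y₂ ω - Y₄ ω) (m2.sub m4),
    lintegral_enorm_sq (f := fun ω => Y₁ ω - Y₃ ω) (m1.sub m3)]
  exact ENNReal.ofReal_le_ofReal (integral_norm_sq_sub_le_of_inner_nonneg m1 m2 m3 m4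
    (hπ₁.integral_inner_nonneg hC hπ₂.1 hX hY₁ hY₂ hY₄ h₁ a4)
    (hπ₂.integral_inner_nonneg hC hπ₁.1 hX hY₃ hY₄ hY₂ h₂ a2))

end RandomVariables

/-! ### Contraction in the fibered distance. -/

/-- Three optimal plans can be realized simultaneously. -/
theorem exists_common_optimal_plan (υ₁ υ₂ π₁ π₂ : PRho ρ) :
    ∃ ω : Measure ((Vec d × Vec d) × (Vec d × Vec d) × Vec d),
      ω.map (fun p => (p.1.1, p.2.1.1, p.1.2)) ∈ Opt υ₁ υ₂ ∧
      ω.map (fun p => (p.1.1, p.2.1.1, p.2.1.2)) ∈ Opt υ₁ π₁ ∧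
      ω.map (fun p => (p.1.1, p.1.2, p.2.2)) ∈ Opt υ₂ π₂ := by
  obtain ⟨α, hα⟩ := exists_mem_opt υ₁ υ₂
  obtain ⟨α₁, hα₁⟩ := exists_mem_opt υ₁ π₁
  obtain ⟨α₂, hα₂⟩ := exists_mem_opt υ₂ π₂
  have := hα.1.1.prob
  have := hα₁.1.1.prob
  have := hα₂.1.1.prob
  have hassoc : Measurable fun p : Vec d × Vec d × Vec d => ((p.1, p.2.1), p.2.2) := by fun_prop
  have hperm : Measurable fun p : (Vec d × Vec d) × Vec d × Vec d =>
    ((p.1.1, p.2.1), (p.1.2, p.2.2)) := by fun_prop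
  have := Measure.isProbabilityMeasure_map (μ := α) hassoc.aemeasurable
  have := Measure.isProbabilityMeasure_map (μ := α₁) hassoc.aemeasurable
  have := Measure.isProbabilityMeasure_map (μ := α₂) hassoc.aemeasurable
  -- The plans form a chain `π₁ – υ₁ – υ₂ – π₂`: glue first over `(x, u₁)`, then regroup and glue
  -- over `(x, u₂)`.
  set β := glue (α.map fun p => ((p.1, p.2.1), p.2.2)) (α₁.map fun p => ((p.1, p.2.1), p.2.2))
    with hβ
  have hβ1 := map_left_glue (α.map fun p => ((p.1, p.2.1), p.2.2))
    (α₁.map fun p => ((p.1, p.2.1), p.2.2))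
  have hβ2 := map_right_glue (α.map fun p => ((p.1, p.2.1), p.2.2))
    (α₁.map fun p => ((p.1, p.2.1), p.2.2)) (by
      rw [Measure.fst, Measure.fst, Measure.map_map (by fun_prop) (by fun_prop),
        Measure.map_map (by fun_prop) (by fun_prop)]
      exact hα.1.2.1.trans hα₁.1.2.1.symm)
  rw [← hβ] at hβ1 hβ2
  have hβα : β.map (fun p => (p.1.1, p.1.2, p.2.1)) = α := by
    have := congrArg (Measure.map fun p : (Vec d × Vec d) × Vec d => (p.1.1, p.1.2, p.2)) hβ1
    rw [Measure.map_map (by fun_prop) (by fun_prop),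
      Measure.map_map (by fun_prop) (by fun_prop)] at this
    exact this.trans Measure.map_id
  have hβα₁ : β.map (fun p => (p.1.1, p.1.2, p.2.2)) = α₁ := by
    have := congrArg (Measure.map fun p : (Vec d × Vec d) × Vec d => (p.1.1, p.1.2, p.2)) hβ2
    rw [Measure.map_map (by fun_prop) (by fun_prop),
      Measure.map_map (by fun_prop) (by fun_prop)] at this
    exact this.trans Measure.map_id
  have : IsProbabilityMeasure β := by rw [hβ, glue]; infer_instance
  have := Measure.isProbabilityMeasure_map (μ := β) hperm.aemeasurable
  set β' := β.map fun p => ((p.1.1, p.2.1), (p.1.2, p.2.2)) with hβ'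
  have hβ'α : β'.map (fun p => (p.1.1, p.2.1, p.1.2)) = α := by
    rw [hβ', Measure.map_map (by fun_prop) (by fun_prop)]
    exact hβα
  have hβ'α₁ : β'.map (fun p => (p.1.1, p.2.1, p.2.2)) = α₁ := by
    rw [hβ', Measure.map_map (by fun_prop) (by fun_prop)]
    exact hβα₁
  have hω1 := map_left_glue β' (α₂.map fun p => ((p.1, p.2.1), p.2.2))
  have hω2 := map_right_glue β' (α₂.map fun p => ((p.1, p.2.1), p.2.2)) (by
      rw [Measure.fst, Measure.fst, Measure.map_map (by fun_prop) (by fun_prop),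
        Measure.map_map (by fun_prop) (by fun_prop)]
      refine Eq.trans ?_ hα₂.1.2.1.symm
      rw [← hα.1.2.2, ← hβα, Measure.map_map (by fun_prop) (by fun_prop)]
      rfl)
  refine ⟨glue β' (α₂.map fun p => ((p.1, p.2.1), p.2.2)), ?_, ?_, ?_⟩
  · convert hα using 1
    have := congrArg (Measure.map fun p : (Vec d × Vec d) × Vec d × Vec d =>
      (p.1.1, p.2.1, p.1.2)) hω1
    rw [Measure.map_map (by fun_prop) (by fun_prop), hβ'α] at this
    exact this
  · convert hα₁ using 1
    have := congrArg (Measure.map fun p : (Vec d × Vec d) × Vec d × Vec d =>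
      (p.1.1, p.2.1, p.2.2)) hω1
    rw [Measure.map_map (by fun_prop) (by fun_prop), hβ'α₁] at this
    exact this
  · convert hα₂ using 1
    have := congrArg (Measure.map fun p : (Vec d × Vec d) × Vec d => (p.1.1, p.1.2, p.2)) hω2
    rw [Measure.map_map (by fun_prop) (by fun_prop),
      Measure.map_map (by fun_prop) (by fun_prop)] at this
    exact this.trans Measure.map_id

/-- In the common plan the right side of the contraction is exactly the squared distance of `υ₁` and
`υ₂`, while the induced plan between `π₁` and `π₂` is merely admissible. -/
theorem IsClosestPoint.wRho_le (hC : IsClosedConvex C) {υ₁ υ₂ π₁ π₂ : PRho ρ}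
    (hπ₁ : IsClosestPoint C υ₁ π₁) (hπ₂ : IsClosestPoint C υ₂ π₂) :
    wRho π₁ π₂ ≤ wRho υ₁ υ₂ := by
  obtain ⟨ω, h, h₁, h₂⟩ := exists_common_optimal_plan υ₁ υ₂ π₁ π₂
  have hle := hπ₁.lintegral_sq_sub_le hC hπ₂ (P := ω) (X := fun p => p.1.1)
    (Y₁ := fun p => p.2.1.1) (Y₂ := fun p => p.2.1.2) (Y₃ := fun p => p.1.2)
    (Y₄ := fun p => p.2.2) (by fun_prop) (by fun_prop) (by fun_prop) (by fun_prop) (by fun_prop)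
    h₁ h₂
  have hopt := h.2
  rw [lintegral_map (by fun_prop) (by fun_prop)] at hopt
  have hdist := wRho_le_eLpNorm (P := ω) (X := fun p => p.1.1) (Y := fun p => p.2.1.2)
    (Y' := fun p => p.2.2) (by fun_prop) (by fun_prop) (by fun_prop)
    ((map_mem_adm_iff (by fun_prop) (by fun_prop) (by fun_prop)).1 h₁.1).2
    ((map_mem_adm_iff (by fun_prop) (by fun_prop) (by fun_prop)).1 h₂.1).2
  rw [← ENNReal.pow_le_pow_left_iff (two_ne_zero), eLpNorm_two_sq] at hdist
  rw [← ENNReal.pow_le_pow_left_iff (two_ne_zero), hopt]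
  exact hdist.trans hle

end FiberedWasserstein

end

open FiberedWasserstein

theorem mainTheorem4 (d : ℕ) (ρ : Measure (Vec d))
    (hρ : IsP2 ρ) (C : Set (PRho ρ))
    (hC : IsClosedConvex C) :
    ∃ P : PRho ρ → PRho ρ,
      -- existence and uniqueness of the closest point
      (∀ υ, IsClosestPoint C υ (P υ) ∧
        ∀ π, IsClosestPoint C υ π → π = P υ) ∧
      -- obtuse angle inequality
      (∀ υ, ∀ η ∈ C,
        ∀ β : Measure (Vec d × Vec d ×
            Vec d × Vec d),
          IsP2 β →
          β.map (fun p => (p.1, p.2.1, p.2.2.1)) ∈ Opt υ (P υ) →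
          β.map (fun p => (p.1, p.2.1, p.2.2.2)) ∈ Adm υ η →
          0 ≤ ∫ p, inner ℝ (p.2.1 - p.2.2.1) (p.2.2.1 - p.2.2.2) ∂β) ∧
      -- converse characterization
      (∀ υ, ∀ ζ ∈ C,
        (∀ η ∈ C, ∃ β : Measure (Vec d × Vec d ×
            Vec d × Vec d),
          IsP2 β ∧
          β.map (fun p => (p.1, p.2.1, p.2.2.1)) ∈ Adm υ ζ ∧
          β.map (fun p => (p.1, p.2.1, p.2.2.2)) ∈ Opt υ η ∧
          0 ≤ ∫ p, inner ℝ (p.2.1 - p.2.2.1) (p.2.2.1 - p.2.2.2) ∂β) →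
        ζ = P υ) ∧
      -- contraction along couplings
      (∀ υ₁ υ₂, ∀ ω : Measure (Vec d × Vec d ×
            Vec d × Vec d × Vec d),
          IsP2 ω →
          ω.map (fun p => (p.1, p.2.1, p.2.2.1)) ∈ Opt υ₁ (P υ₁) →
          ω.map (fun p => (p.1, p.2.2.2.1, p.2.2.2.2)) ∈ Opt υ₂ (P υ₂) →
          ∫⁻ p, ‖p.2.2.1 - p.2.2.2.2‖ₑ ^ 2 ∂ω ≤ ∫⁻ p, ‖p.2.1 - p.2.2.2.1‖ₑ ^ 2 ∂ω) ∧
      -- contraction in the distance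
      (∀ υ₁ υ₂, wRho (P υ₁) (P υ₂) ≤ wRho υ₁ υ₂) := by

  choose P hP using hC.exists_isClosestPoint
  refine ⟨P, fun υ => ⟨hP υ, fun π hπ => (hP υ).unique hC hπ⟩, ?_, ?_, ?_,
    fun υ₁ υ₂ => (hP υ₁).wRho_le hC (hP υ₂)⟩
  · intro υ η hη β _ hopt hadm
    exact (hP υ).integral_inner_nonneg hC hη (by fun_prop) (by fun_prop) (by fun_prop)
      (by fun_prop) hopt
      ((map_mem_adm_iff (by fun_prop) (by fun_prop) (by fun_prop)).1 hadm).2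
  · intro υ ζ hζ h
    refine (hP υ).unique hC ⟨hζ, fun η hη => sqDist_le_sqDist_iff.1 ?_⟩
    obtain ⟨β, _, hadm, hopt, hβ⟩ := h η hη
    exact sqDist_le_of_integral_inner_nonneg (by fun_prop) (by fun_prop) (by fun_prop)
      (by fun_prop) hadm hopt hβ
  · intro υ₁ υ₂ ω _ h₁ h₂
    exact (hP υ₁).lintegral_sq_sub_le hC (hP υ₂) (by fun_prop) (by fun_prop) (by fun_prop)
      (by fun_prop) (by fun_prop) h₁ h₂
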